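/- Let $n\ge 2$ and $d\ge 1$ be integers. For a set $E\subset\mathbb{R}^d$ and a point $x\in E$, define the pinned $n$-linear box set $$\Box_{n,x}(E)=\left\{\,|(y^1,\dots,y^n)-(x,\dots,x)| : y^1,\dots,y^n\in E,\ y^i\ne y^j \text{ whenever } i\neq j\right\}\subset\mathbb{R},$$ where $|\cdot|$ is the Euclidean norm on $(\mathbb{R}^d)^n=\mathbb{R}^{nd}$. Let $E\subset\mathbb{R}^d$ be a compact set whose Hausdorff dimension satisfies $$\dim_{\mathcal H}(E)>\begin{cases}\dfrac34, & (n,d)=(2,1),\\[2mm] d\left(\dfrac{n}{n+1}\right), & (n,d)\ne(2,1).\end{cases}$$ Then there exists $x\in E$ such that $\mathcal{L}^1(\Box_{n,x}(E))>0$, where $\mathcal{L}^1$ denotes one-dimensional Lebesgue measure. -/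

import Mathlib

open scoped NNReal ENNReal

/-- The pinned `n`-linear box set of `E ⊆ ℝᵈ` at `x`: the set of all Euclidean distances in
`(ℝᵈ)ⁿ = ℝⁿᵈ` between `(y¹, …, yⁿ)` and the diagonal point `(x, …, x)`, where `y¹, …, yⁿ` are
pairwise distinct points of `E`. `PiLp 2` carries the Euclidean (`ℓ²`) norm of the product. -/
def pinnedBoxSet (n : ℕ) {d : ℕ} (x : EuclideanSpace ℝ (Fin d))
    (E : Set (EuclideanSpace ℝ (Fin d))) : Set ℝ :=
  {t : ℝ | ∃ y : PiLp 2 (fun _ : Fin n => EuclideanSpace ℝ (Fin d)),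
    (∀ i, y i ∈ E) ∧ (∀ i j, i ≠ j → y i ≠ y j) ∧
      t = ‖y - WithLp.toLp 2 (fun _ : Fin n => x)‖}

/-- The dimensional threshold: `3/4` if `(n, d) = (2, 1)`, and `d * (n / (n + 1))` otherwise. -/
noncomputable def boxThreshold (n d : ℕ) : ℝ≥0 :=
  if (n, d) = (2, 1) then 3 / 4 else (d : ℝ≥0) * ((n : ℝ≥0) / ((n : ℝ≥0) + 1))

open MeasureTheory Set Filter Topology

/-! Two free points suffice. Expanding squares, |y₁ - x|² + |y₂ - x|² = 2|x|² + u + ⟪v, x⟫ with u =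
|y₁|² + |y₂|² and v = -2(y₁ + y₂). For fixed x this is, up to a constant, the projection of (u, v) ∈
ℝ^(d+1) in the direction (1, x). If its law under μ × μ is absolutely continuous, μ a Frostman
measure on E of exponent s, the pinned box set cannot be null; when n > 2 the other points come from
a fixed finite subset of E (`volume_pinnedBoxSet_pos`).

Absolute continuity for μ-almost every x is an exceptional-projection theorem
(`ae_map_absolutelyContinuous`). The Fourier transform of the projected law at τ is that of the law
of (u, v) at (τ, τx). For τ of size R, boundedness of v allows averaging at unit scale in the last d
variables, and the Frostman condition for τx gains R^(-s). The energy of the law of (u, v) at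
frequencies up to R is R^(d+1-a), if two independent samples are within r of each other with
probability at most of order r^a. The dyadic pieces R^(d+1-s-a) are summable when s + a > d + 1.

The exponent a = s + b comes from geometry (`exists_correlation_le`): if (p, q) and (w, z) give
nearby values, then p, w, q, z is nearly a rectangle. So z lies in a ball of radius r, contributing
r^s, and q lies in a strip normal to w - p, contributing r^b if strips have exponent b. The
requirement becomes 2s + b > d + 1. It is met with b = 1/2 for d = 1, b = s - 1 for d = 2 and b = 0
for d ≥ 3. -/

/-! ### Hausdorff content and Frostman measures -/

/-- The `s`-dimensional Hausdorff content, as an outer measure. -/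
noncomputable def hausdorffContent (X : Type*) [PseudoEMetricSpace X] (s : ℝ) : OuterMeasure X :=
  OuterMeasure.boundedBy fun A => Metric.ediam A ^ s

lemma hausdorffContent_le {X : Type*} [PseudoEMetricSpace X] (s : ℝ) (A : Set X) :
    hausdorffContent X s A ≤ Metric.ediam A ^ s :=
  OuterMeasure.boundedBy_le A

/-- A cover whose sum of s-th powers of diameters is tiny consists of tiny sets, so zero content
already forces zero Hausdorff measure at every scale. -/
lemma hausdorffContent_ne_zero {X : Type*} [EMetricSpace X] [MeasurableSpace X] [BorelSpace X]
    {s : ℝ} (hs : 0 < s) {A : Set X} (hA : μH[s] A ≠ 0) : hausdorffContent X s A ≠ 0 := by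
  intro h0
  apply hA
  rw [Measure.hausdorffMeasure_apply]
  refine le_antisymm (iSup₂_le fun r hr => ?_) bot_le
  refine le_of_forall_gt fun ε hε => ?_
  -- The bound `ε` controls the sum; the bound `r ^ s` forces every piece to have diameter at most
  -- `r`.
  have hlt : hausdorffContent X s A < min ε (r ^ s) := by
    rw [h0]; exact lt_min hε (ENNReal.rpow_pos_of_nonneg hr hs.le)
  rw [hausdorffContent, OuterMeasure.boundedBy_apply] at hlt
  simp only [iInf_lt_iff] at hlt
  obtain ⟨t, ht, hlt⟩ := hlt
  have hdiam : ∀ n, Metric.ediam (t n) ≤ r := fun n => by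
    rcases (t n).eq_empty_or_nonempty with h | h
    · simp [h]
    · have h1 : Metric.ediam (t n) ^ s ≤ r ^ s := by
        refine le_trans ?_ (hlt.le.trans (min_le_right _ _))
        refine le_trans ?_ (ENNReal.le_tsum n)
        simp [h]
      exact (ENNReal.rpow_le_rpow_iff hs).1 h1
  refine lt_of_le_of_lt ?_ (hlt.trans_le (min_le_left _ _))
  exact (iInf₂_le t ht).trans (iInf_le _ hdiam)

/-- Distributing an outer measure along finitely many successively refining partitions. -/
lemma exists_measure_le_outerMeasure_cells {α ι : Type*} [MeasurableSpace α]
    [MeasurableSpace ι] [MeasurableSingletonClass ι] (h : OuterMeasure α) (q : ℕ → α → ι)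
    (hq : ∀ k, Measurable (q k)) (href : ∀ k j x y, k ≤ j → q j x = q j y → q k x = q k y)
    (k : ℕ) : ∀ (m : ℕ) (A : Set α), MeasurableSet A → h A ≠ ∞ → (∀ j, (q j '' A).Finite) →
      ∃ ν : Measure α, ν Aᶜ = 0 ∧ ν univ = h A ∧
        ∀ j c, m ≤ j → j < m + k → ν (q j ⁻¹' {c}) ≤ h (A ∩ q j ⁻¹' {c}) := by
  classical
  induction k with
  | zero =>
    intro m A hA _ _
    rcases A.eq_empty_or_nonempty with rfl | ⟨a, ha⟩
    · exact ⟨0, by simp, by simp, fun j c h1 h2 => by omega⟩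
    · refine ⟨h A • Measure.dirac a, ?_, by simp, fun j c h1 h2 => by omega⟩
      simp [Measure.dirac_apply' a hA.compl, ha]
  | succ k ih =>
    intro m A hA hfin hA'
    set I := (hA' m).toFinset with hI
    let B : ι → Set α := fun i => A ∩ q m ⁻¹' {i}
    have hBA : ∀ i, B i ⊆ A := fun i => inter_subset_left
    have hBm : ∀ i, MeasurableSet (B i) := fun i => hA.inter (hq m (measurableSet_singleton i))
    have key := fun i => ih (m + 1) (B i) (hBm i) (ne_top_of_le_ne_top hfin (h.mono (hBA i)))
      (fun j => (hA' j).subset (image_mono (hBA i)))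
    choose ν h1 h2 h3 using key
    set S := ∑ i ∈ I, h (B i) with hS
    have hAS : h A ≤ S := by
      refine (h.mono (s₂ := ⋃ i ∈ I, B i) fun x hx => ?_).trans (measure_biUnion_finset_le I B)
      simp only [mem_iUnion]
      exact ⟨q m x, by simpa [hI] using ⟨x, hx, rfl⟩, hx, rfl⟩
    have hStop : S ≠ ∞ := by
      rw [hS, ENNReal.sum_ne_top]
      exact fun i _ => ne_top_of_le_ne_top hfin (h.mono (hBA i))
    -- The cell measures add up to `S ≥ h A` by subadditivity; scaling by `h A / S ≤ 1` restores the
    -- total mass and can only improve the bounds on cells.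
    have hθ : h A / S * S = h A := by
      rcases eq_or_ne S 0 with h0 | h0
      · rw [h0] at hAS ⊢; simpa using (le_antisymm hAS bot_le).symm
      · exact ENNReal.div_mul_cancel h0 hStop
    have hθ1 : h A / S ≤ 1 := ENNReal.div_le_of_le_mul (by simpa using hAS)
    have hνB : ∀ i, ν i (B i) ≤ h (B i) := fun i => (measure_mono (subset_univ _)).trans (h2 i).le
    refine ⟨(h A / S) • ∑ i ∈ I, ν i, ?_, ?_, ?_⟩
    · simp only [Measure.smul_apply, Measure.coe_finsetSum, Finset.sum_apply, smul_eq_mul]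
      rw [Finset.sum_eq_zero, mul_zero]
      exact fun i _ => measure_mono_null (compl_subset_compl.2 (hBA i)) (h1 i)
    · simp only [Measure.smul_apply, Measure.coe_finsetSum, Finset.sum_apply, smul_eq_mul, h2]
      exact hθ
    · intro j c hmj hjk
      simp only [Measure.smul_apply, Measure.coe_finsetSum, Finset.sum_apply, smul_eq_mul]
      refine (mul_le_of_le_one_left zero_le hθ1).trans ?_
      rcases (q j ⁻¹' {c}).eq_empty_or_nonempty with he | ⟨x, hx⟩
      · simp [he]
      -- A finer cell lies in a single cell of generation `m`, so only one summand charges it.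
      have hzero : ∀ i ∈ I, i ≠ q m x → ν i (q j ⁻¹' {c}) = 0 := by
        intro i _ hi
        refine measure_mono_null (t := (B i)ᶜ) (fun y hy hyB => hi ?_) (h1 i)
        have : q m y = q m x := href m j y x hmj (by rw [hx, hy])
        rw [← this]; exact hyB.2.symm
      have hle : ∑ i ∈ I, ν i (q j ⁻¹' {c}) ≤ ν (q m x) (q j ⁻¹' {c}) := by
        by_cases hxI : q m x ∈ I
        · rw [Finset.sum_eq_single_of_mem _ hxI fun i hi hne => hzero i hi hne]
        · rw [Finset.sum_eq_zero fun i hi => hzero i hi fun he => hxI (he ▸ hi)]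
          exact zero_le
      refine hle.trans ?_
      rcases hmj.eq_or_lt with rfl | hlt
      · have hc : q m x = c := hx
        rw [hc]
        exact (measure_mono (subset_univ _)).trans (h2 c).le
      · exact (h3 _ j c hlt (by omega)).trans (h.mono (inter_subset_inter_left _ (hBA _)))

section Frostman
variable {d : ℕ}

/-- The index of the dyadic cube of side `2⁻ᵏ` containing a point. -/
noncomputable def dyadicIndex (k : ℕ) (x : EuclideanSpace ℝ (Fin d)) : Fin d → ℤ :=
  fun i => ⌊(2 : ℝ) ^ k * x i⌋

lemma measurable_dyadicIndex (k : ℕ) : Measurable (dyadicIndex (d := d) k) := by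
  unfold dyadicIndex
  refine measurable_pi_lambda _ fun i => Int.measurable_floor.comp ?_
  fun_prop

lemma dyadicIndex_refine {k j : ℕ} (hkj : k ≤ j) {x y : EuclideanSpace ℝ (Fin d)}
    (h : dyadicIndex j x = dyadicIndex j y) : dyadicIndex k x = dyadicIndex k y := by
  obtain ⟨l, rfl⟩ := Nat.exists_eq_add_of_le hkj
  have key : ∀ z : EuclideanSpace ℝ (Fin d), ∀ i,
      dyadicIndex k z i = dyadicIndex (k + l) z i / ((2 ^ l : ℕ) : ℤ) := by
    intro z i
    have := Int.floor_div_natCast ((2 : ℝ) ^ (k + l) * z i) (2 ^ l)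
    simp only [dyadicIndex]
    rw [← this]
    congr 1
    push_cast
    rw [pow_add]
    field_simp
  funext i
  rw [key x, key y, h]

lemma finite_image_dyadicIndex (k : ℕ) {E : Set (EuclideanSpace ℝ (Fin d))}
    (hE : Bornology.IsBounded E) : (dyadicIndex k '' E).Finite := by
  obtain ⟨M, hM⟩ := hE.exists_norm_le
  refine (Set.finite_Icc (fun _ : Fin d => ⌊-((2 : ℝ) ^ k * M)⌋)
    (fun _ => ⌊(2 : ℝ) ^ k * M⌋)).subset ?_
  rintro _ ⟨x, hx, rfl⟩
  have hi : ∀ i, |x i| ≤ M := fun i => (PiLp.norm_apply_le x i).trans (hM x hx)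
  refine ⟨fun i => Int.floor_mono ?_, fun i => Int.floor_mono ?_⟩
  · have := (abs_le.1 (hi i)).1
    rw [← mul_neg]; gcongr
  · have := (abs_le.1 (hi i)).2
    gcongr

lemma ediam_dyadicCell_le (k : ℕ) (c : Fin d → ℤ) :
    Metric.ediam (dyadicIndex k ⁻¹' {c}) ≤ ENNReal.ofReal (Real.sqrt d * (2 : ℝ)⁻¹ ^ k) := by
  refine Metric.ediam_le fun x hx y hy => ?_
  rw [edist_dist]
  refine ENNReal.ofReal_le_ofReal ?_
  have hxy : ∀ i, dist (x i) (y i) ^ 2 ≤ ((2 : ℝ)⁻¹ ^ k) ^ 2 := by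
    intro i
    have h1 : ⌊(2 : ℝ) ^ k * x i⌋ = ⌊(2 : ℝ) ^ k * y i⌋ :=
      (congrFun (hx : dyadicIndex k x = c) i).trans (congrFun (hy : dyadicIndex k y = c) i).symm
    have h2 := Int.abs_sub_lt_one_of_floor_eq_floor h1
    rw [← mul_sub, abs_mul, abs_of_pos (by positivity : (0 : ℝ) < 2 ^ k)] at h2
    have : dist (x i) (y i) ≤ (2 : ℝ)⁻¹ ^ k := by
      rw [Real.dist_eq, inv_pow, ← one_div, le_div_iff₀ (by positivity), mul_comm]
      exact h2.le
    gcongr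
  rw [EuclideanSpace.dist_eq]
  refine Real.sqrt_le_iff.2 ⟨by positivity, ?_⟩
  rw [mul_pow, Real.sq_sqrt (by positivity)]
  refine (Finset.sum_le_sum fun i _ => hxy i).trans ?_
  simp

/-- Each coordinate index moves by at most one, so 3^d cells are enough. -/
lemma ball_subset_iUnion_dyadicCell (k : ℕ) (x : EuclideanSpace ℝ (Fin d)) {r : ℝ}
    (hr : r ≤ (2 : ℝ)⁻¹ ^ k) :
    Metric.ball x r ⊆ ⋃ c ∈ Finset.Icc (dyadicIndex k x - 1) (dyadicIndex k x + 1),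
      dyadicIndex k ⁻¹' {c} := by
  intro y hy
  have hi : ∀ i, |(2 : ℝ) ^ k * y i - 2 ^ k * x i| < 1 := by
    intro i
    have h1 : |y i - x i| ≤ dist y x := by
      rw [dist_eq_norm]; exact PiLp.norm_apply_le (y - x) i
    have h2 : |y i - x i| < (2 : ℝ)⁻¹ ^ k := h1.trans_lt ((Metric.mem_ball.1 hy).trans_le hr)
    rw [← mul_sub, abs_mul, abs_of_pos (by positivity : (0 : ℝ) < 2 ^ k)]
    rw [inv_pow] at h2
    calc (2 : ℝ) ^ k * |y i - x i| < 2 ^ k * (2 ^ k)⁻¹ := by gcongr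
      _ = 1 := mul_inv_cancel₀ (by positivity)
  simp only [mem_iUnion]
  refine ⟨dyadicIndex k y, Finset.mem_Icc.2 ⟨fun i => ?_, fun i => ?_⟩, rfl⟩
  · have := abs_lt.1 (hi i)
    simp only [dyadicIndex, Pi.sub_apply, Pi.one_apply]
    rw [← Int.floor_sub_one]
    exact Int.floor_mono (by linarith)
  · have := abs_lt.1 (hi i)
    simp only [dyadicIndex, Pi.add_apply, Pi.one_apply]
    rw [← Int.floor_add_one]
    exact Int.floor_mono (by linarith)

/-- **Frostman's lemma** for compact subsets of Euclidean space. -/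
theorem exists_frostman_measure {E : Set (EuclideanSpace ℝ (Fin d))} (hE : IsCompact E)
    {s : ℝ} (hs : 0 < s) (hpos : μH[s] E ≠ 0) :
    ∃ μ : Measure (EuclideanSpace ℝ (Fin d)), IsProbabilityMeasure μ ∧ μ Eᶜ = 0 ∧
      ∃ C : ℝ≥0, ∀ x r, 0 < r → μ (Metric.closedBall x r) ≤ C * ENNReal.ofReal r ^ s := by
  set h := hausdorffContent (EuclideanSpace ℝ (Fin d)) s with hh
  have h0 : h E ≠ 0 := hausdorffContent_ne_zero hs hpos
  have htop : h E ≠ ∞ := ne_top_of_le_ne_top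
    (ENNReal.rpow_ne_top_of_nonneg hs.le hE.isBounded.ediam_ne_top) (hausdorffContent_le s E)
  have key := fun k => exists_measure_le_outerMeasure_cells h (dyadicIndex (d := d))
    measurable_dyadicIndex (fun k j x y hkj hxy => dyadicIndex_refine hkj hxy) k 0 E
    hE.measurableSet htop (fun j => finite_image_dyadicIndex j hE.isBounded)
  choose ν hν1 hν2 hν3 using key
  let P : ℕ → ProbabilityMeasure (EuclideanSpace ℝ (Fin d)) := fun k =>
    ⟨(h E)⁻¹ • ν k, ⟨by simp [hν2, ENNReal.inv_mul_cancel h0 htop]⟩⟩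
  have hPapply : ∀ k A, (P k : Measure (EuclideanSpace ℝ (Fin d))) A = (h E)⁻¹ * ν k A :=
    fun k A => rfl
  have hPE : ∀ k, (P k) Eᶜ = 0 := fun k => by
    rw [ProbabilityMeasure.null_iff_toMeasure_null, hPapply, hν1, mul_zero]
  have hcomp := isCompact_setOfPred_probabilityMeasure_mass_eq_compl_isCompact_le
    (E := EuclideanSpace ℝ (Fin d)) (u := fun _ => 0) (K := fun _ => E) tendsto_const_nhds
    (fun _ => hE) (Or.inr monotone_const)
  -- Probability measures carried by the compact set `E` form a weakly compact set; a limit along a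
  -- free ultrafilter replaces a convergent subsequence.
  obtain ⟨μ, hμ, hlim⟩ := hcomp.ultrafilter_le_nhds ((hyperfilter ℕ).map P) (by
    rw [Ultrafilter.coe_map, le_principal_iff]
    exact Filter.mem_map.2 (univ_mem' fun k n => (hPE k).le))
  have hlim' : Tendsto P (hyperfilter ℕ) (𝓝 μ) := hlim
  set D : ℝ := Real.sqrt d with hD
  set N : ℝ≥0∞ := (3 : ℝ≥0∞) ^ d with hN
  have hball : ∀ x (k : ℕ) r, r ≤ (2 : ℝ)⁻¹ ^ k → (μ : Measure (EuclideanSpace ℝ (Fin d))) (Metric.ball x r) ≤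
      (h E)⁻¹ * (N * ENNReal.ofReal (D * (2 : ℝ)⁻¹ ^ k) ^ s) := by
    intro x k r hr
    refine (ProbabilityMeasure.le_liminf_measure_open_of_tendsto hlim' Metric.isOpen_ball).trans ?_
    refine liminf_le_of_frequently_le' (Eventually.frequently ?_)
    have : ∀ᶠ j in (hyperfilter ℕ : Filter ℕ), k < j :=
      (Nat.hyperfilter_le_atTop) (eventually_gt_atTop k)
    filter_upwards [this] with j hj
    rw [hPapply]
    gcongr
    refine (measure_mono (ball_subset_iUnion_dyadicCell k x hr)).trans ?_
    refine (measure_biUnion_finset_le _ _).trans ?_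
    refine (Finset.sum_le_card_nsmul _ _ _ fun c _ => ((hν3 j k c zero_le (by omega)).trans
      (h.mono inter_subset_right)).trans ((hausdorffContent_le s _).trans
        (ENNReal.rpow_le_rpow (ediam_dyadicCell_le k c) hs.le))).trans ?_
    rw [nsmul_eq_mul, hN]
    gcongr
    rw [Pi.card_Icc]
    have : ∀ i, (Finset.Icc ((dyadicIndex k x - 1) i) ((dyadicIndex k x + 1) i)).card = 3 := by
      intro i
      rw [Int.card_Icc, Pi.add_apply, Pi.sub_apply, Pi.one_apply]
      omega
    rw [Finset.prod_congr rfl fun i _ => this i]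
    simp
  have hNtop : N ≠ ∞ := by simp [hN]
  -- The first entry serves radii with `2 * r ≥ 1`, where the total mass is enough. The second
  -- serves small radii: the dyadic side just above `2 * r` is at most `4 * r`.
  set C : ℝ≥0∞ := max (ENNReal.ofReal 2 ^ s) ((h E)⁻¹ * (N * ENNReal.ofReal (D * 4) ^ s)) with hC
  have hCtop : C ≠ ∞ := by
    rw [hC]
    refine (max_lt (ENNReal.rpow_lt_top_of_nonneg hs.le (by simp)) ?_).ne
    exact ENNReal.mul_lt_top (by simpa using pos_iff_ne_zero.2 h0) (ENNReal.mul_lt_top hNtop.lt_top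
      (ENNReal.rpow_lt_top_of_nonneg hs.le (by simp)))
  refine ⟨μ, inferInstance, ?_, C.toNNReal, fun x r hr => ?_⟩
  · have := hμ 0
    rw [← ProbabilityMeasure.null_iff_toMeasure_null]
    exact le_antisymm this zero_le
  rw [ENNReal.coe_toNNReal hCtop]
  rcases le_total 1 (2 * r) with h1 | h1
  · calc (μ : Measure (EuclideanSpace ℝ (Fin d))) (Metric.closedBall x r) ≤ 1 := prob_le_one
      _ ≤ ENNReal.ofReal (2 * r) ^ s := by
        rw [← ENNReal.one_rpow s]
        exact ENNReal.rpow_le_rpow (ENNReal.one_le_ofReal.2 h1) hs.le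
      _ = ENNReal.ofReal 2 ^ s * ENNReal.ofReal r ^ s := by
        rw [ENNReal.ofReal_mul (by norm_num), ENNReal.mul_rpow_of_nonneg _ _ hs.le]
      _ ≤ C * ENNReal.ofReal r ^ s := by
        gcongr
        exact le_max_left _ _
  · obtain ⟨k, hk1, hk2⟩ := exists_nat_pow_near_of_lt_one (by positivity : 0 < 2 * r) h1
      (by norm_num : (0 : ℝ) < 2⁻¹) (by norm_num)
    calc (μ : Measure (EuclideanSpace ℝ (Fin d))) (Metric.closedBall x r)
        ≤ (μ : Measure (EuclideanSpace ℝ (Fin d))) (Metric.ball x (2 * r)) :=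
          measure_mono (Metric.closedBall_subset_ball (by linarith))
      _ ≤ (h E)⁻¹ * (N * ENNReal.ofReal (D * (2 : ℝ)⁻¹ ^ k) ^ s) := hball x k _ hk2
      _ ≤ (h E)⁻¹ * (N * ENNReal.ofReal (D * 4 * r) ^ s) := by
        have hD0 : 0 ≤ D := Real.sqrt_nonneg _
        rw [pow_succ] at hk1
        have : D * (2 : ℝ)⁻¹ ^ k ≤ D * 4 * r := by
          rw [mul_assoc]
          exact mul_le_mul_of_nonneg_left (by linarith) hD0
        gcongr
      _ = (h E)⁻¹ * (N * ENNReal.ofReal (D * 4) ^ s) * ENNReal.ofReal r ^ s := by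
        rw [ENNReal.ofReal_mul (mul_nonneg (Real.sqrt_nonneg _) (by norm_num)),
          ENNReal.mul_rpow_of_nonneg _ _ hs.le]
        ring
      _ ≤ C * ENNReal.ofReal r ^ s := by
        gcongr
        exact le_max_right _ _

end Frostman

/-! ### Cauchy–Schwarz, Gaussian tails and a criterion for absolute continuity -/

lemma sq_lintegral_le {α : Type*} [MeasurableSpace α] (μ : Measure α) {f : α → ℝ≥0∞}
    (hf : AEMeasurable f μ) : (∫⁻ x, f x ∂μ) ^ 2 ≤ μ univ * ∫⁻ x, f x ^ 2 ∂μ := by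
  have h := ENNReal.lintegral_mul_le_Lp_mul_Lq μ Real.HolderConjugate.two_two hf
    (aemeasurable_const (b := (1 : ℝ≥0∞)))
  simp only [Pi.mul_apply, mul_one, ENNReal.one_rpow, lintegral_const, one_mul] at h
  calc (∫⁻ x, f x ∂μ) ^ 2 ≤ ((∫⁻ x, f x ^ (2 : ℝ) ∂μ) ^ (1 / 2 : ℝ) * μ univ ^ (1 / 2 : ℝ)) ^ 2 := by
        gcongr
    _ = μ univ * ∫⁻ x, f x ^ 2 ∂μ := by
        rw [mul_pow, ← ENNReal.rpow_natCast, ← ENNReal.rpow_natCast, ← ENNReal.rpow_mul,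
          ← ENNReal.rpow_mul, mul_comm]
        norm_num

/-- The constant in the Gaussian tail estimate `lintegral_exp_neg_sq_le`. -/
noncomputable def gaussTailConst (a : ℝ) : ℝ≥0∞ :=
  ∑' k : ℕ, ENNReal.ofReal (Real.exp (-(k : ℝ) ^ 2)) * ENNReal.ofReal (k + 1) ^ a

lemma gaussTailConst_ne_top (a : ℝ) : gaussTailConst a ≠ ∞ := by
  obtain ⟨N, hN⟩ := exists_nat_ge a
  have hsum := (Real.summable_pow_mul_exp_neg_nat_mul N one_pos)
  have hsum1 := ((summable_nat_add_iff 1).2 hsum).mul_left (Real.exp 1)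
  refine ne_top_of_le_ne_top hsum1.tsum_ofReal_ne_top (ENNReal.tsum_le_tsum fun k => ?_)
  rw [ENNReal.ofReal_rpow_of_pos (by positivity), ← ENNReal.ofReal_mul (Real.exp_pos _).le]
  refine ENNReal.ofReal_le_ofReal ?_
  have h1 : ((k : ℝ) + 1) ^ a ≤ ((k : ℝ) + 1) ^ N := by
    rw [← Real.rpow_natCast]
    exact Real.rpow_le_rpow_of_exponent_le (by linarith [k.cast_nonneg (α := ℝ)]) hN
  have h2 : Real.exp (-(k : ℝ) ^ 2) ≤ Real.exp 1 * Real.exp (-1 * ((k + 1 : ℕ) : ℝ)) := by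
    rw [← Real.exp_add]
    refine Real.exp_le_exp.2 ?_
    push_cast
    have : (k : ℝ) ≤ (k : ℝ) ^ 2 := by exact_mod_cast Nat.le_self_pow two_ne_zero k
    linarith
  calc Real.exp (-(k : ℝ) ^ 2) * ((k : ℝ) + 1) ^ a
      ≤ (Real.exp 1 * Real.exp (-1 * ((k + 1 : ℕ) : ℝ))) * ((k : ℝ) + 1) ^ N := by gcongr
    _ = _ := by push_cast; ring

/-- A Gaussian of width 1/R behaves like the indicator of `f ≤ 1/R`: the layer with ⌊R f⌋ = k costs
only a factor (k + 1)^a against exp(-k²). -/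
lemma lintegral_exp_neg_sq_le {α : Type*} [MeasurableSpace α] {a : ℝ} (ha : 0 ≤ a) (μ : Measure α)
    {f : α → ℝ} (hf : Measurable f) (hf0 : ∀ x, 0 ≤ f x) {C : ℝ≥0∞}
    (h : ∀ r, 0 < r → μ {x | f x ≤ r} ≤ C * ENNReal.ofReal r ^ a) {R : ℝ} (hR : 0 < R) :
    ∫⁻ x, ENNReal.ofReal (Real.exp (-(R * f x) ^ 2)) ∂μ ≤
      gaussTailConst a * C * ENNReal.ofReal R ^ (-a) := by
  have hpt : ∀ x, ENNReal.ofReal (Real.exp (-(R * f x) ^ 2)) ≤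
      ∑' k : ℕ, {x | f x ≤ (k + 1) / R}.indicator
        (fun _ => ENNReal.ofReal (Real.exp (-(k : ℝ) ^ 2))) x := by
    intro x
    have h0 : 0 ≤ R * f x := mul_nonneg hR.le (hf0 x)
    refine le_trans ?_ (ENNReal.le_tsum ⌊R * f x⌋₊)
    rw [indicator_of_mem]
    · refine ENNReal.ofReal_le_ofReal (Real.exp_le_exp.2 (neg_le_neg ?_))
      exact pow_le_pow_left₀ (Nat.cast_nonneg _) (Nat.floor_le h0) 2
    · rw [mem_ofPred_eq, le_div_iff₀ hR, mul_comm]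
      exact (Nat.lt_floor_add_one _).le
  have hms : ∀ c : ℝ, MeasurableSet {x | f x ≤ c} := fun c => hf measurableSet_Iic
  calc ∫⁻ x, ENNReal.ofReal (Real.exp (-(R * f x) ^ 2)) ∂μ
      ≤ ∫⁻ x, ∑' k : ℕ, {x | f x ≤ (k + 1) / R}.indicator
        (fun _ => ENNReal.ofReal (Real.exp (-(k : ℝ) ^ 2))) x ∂μ := lintegral_mono hpt
    _ = ∑' k : ℕ, ENNReal.ofReal (Real.exp (-(k : ℝ) ^ 2)) * μ {x | f x ≤ (k + 1) / R} := by
        rw [lintegral_tsum fun k => (measurable_const.indicator (hms _)).aemeasurable]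
        congr 1 with k
        rw [lintegral_indicator_const (hms _)]
    _ ≤ ∑' k : ℕ, ENNReal.ofReal (Real.exp (-(k : ℝ) ^ 2)) *
          (C * ENNReal.ofReal ((k + 1) / R) ^ a) := by
        gcongr with k
        exact h _ (by positivity)
    _ = gaussTailConst a * C * ENNReal.ofReal R ^ (-a) := by
        rw [gaussTailConst, mul_assoc, ← ENNReal.tsum_mul_right]
        congr 1 with k
        rw [ENNReal.ofReal_div_of_pos hR, ENNReal.div_rpow_of_nonneg _ _ ha, ENNReal.rpow_neg,
          div_eq_mul_inv]
        ring

/-- A finite measure on `ℝ` with at most linear self-correlations is absolutely continuous. -/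
lemma absolutelyContinuous_of_prod_le (ν : Measure ℝ) [IsFiniteMeasure ν] {C : ℝ≥0∞} (hC : C ≠ ∞)
    (h : ∀ δ : ℝ, 0 < δ → (ν.prod ν) {p | |p.1 - p.2| ≤ δ} ≤ C * ENNReal.ofReal δ) :
    ν ≪ volume := by
  refine Measure.AbsolutelyContinuous.mk fun A hA hA0 => ?_
  by_contra hne
  obtain ⟨K, hKA, hK, hνK⟩ := hA.exists_lt_isCompact (pos_iff_ne_zero.2 hne)
  have hK0 : volume K = 0 := measure_mono_null hKA hA0
  have key : ∀ ε : ℝ≥0∞, 0 < ε → ν K ^ 2 ≤ ε * C := by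
    intro ε hε
    obtain ⟨U, hKU, hU, hUε⟩ := K.exists_isOpen_lt_of_lt ε (by rwa [hK0])
    obtain ⟨δ, hδ, hδU⟩ := hK.exists_thickening_subset_open hU hKU
    set η := δ / 2 with hη
    have hη0 : 0 < η := by positivity
    set D : Set (ℝ × ℝ) := {p | |p.1 - p.2| ≤ η} with hD
    have hDm : MeasurableSet D := by
      refine measurableSet_le ?_ measurable_const
      fun_prop
    let g : ℝ → ℝ → ℝ≥0∞ := fun x t => D.indicator 1 (x, t)
    have hg : Measurable (Function.uncurry g) := measurable_one.indicator hDm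
    have hslice : ∀ t, {x | (x, t) ∈ D} = Metric.closedBall t η := by
      intro t; ext x; simp [hD, Real.dist_eq]
    -- `F x` is the ν-mass of the interval of radius `η` about `x`. Its integral over `U` is at
    -- least `2η ν(K)`, while its mean square is at most a multiple of η² by the correlation
    -- hypothesis. Cauchy–Schwarz on `U`, of length below `ε`, then gives ν(K)² ≤ ε C.
    set F : ℝ → ℝ≥0∞ := fun x => ∫⁻ t, g x t ∂ν with hF
    have hFm : Measurable F := hg.lintegral_prod_right'
    have h1 : ν K * ENNReal.ofReal (2 * η) ≤ ∫⁻ x in U, F x := by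
      rw [hF, lintegral_lintegral_swap hg.aemeasurable]
      calc ν K * ENNReal.ofReal (2 * η) = ∫⁻ t in K, ENNReal.ofReal (2 * η) ∂ν := by
            rw [setLIntegral_const, mul_comm]
        _ ≤ ∫⁻ t in K, (∫⁻ x in U, g x t) ∂ν := by
            refine setLIntegral_mono' hK.measurableSet fun t ht => ?_
            have hsub : Metric.closedBall t η ⊆ U := by
              refine Subset.trans ?_ hδU
              refine Subset.trans ?_ (Metric.ball_subset_thickening ht δ)
              exact Metric.closedBall_subset_ball (by rw [hη]; linarith)
            calc ENNReal.ofReal (2 * η) = volume (Metric.closedBall t η) :=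
                  (Real.volume_closedBall t η).symm
              _ = ∫⁻ x in U, (Metric.closedBall t η).indicator 1 x := by
                  rw [lintegral_indicator_one Metric.isClosed_closedBall.measurableSet,
                    Measure.restrict_apply Metric.isClosed_closedBall.measurableSet,
                    inter_eq_left.2 hsub]
              _ ≤ ∫⁻ x in U, g x t := by
                  refine lintegral_mono fun x => ?_
                  rw [← hslice t]; exact le_rfl
        _ ≤ ∫⁻ t, (∫⁻ x in U, g x t) ∂ν := setLIntegral_le_lintegral _ _
    have h2 : ∫⁻ x in U, F x ^ 2 ≤ ENNReal.ofReal (2 * η) * (C * ENNReal.ofReal (2 * η)) := by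
      calc ∫⁻ x in U, F x ^ 2 ≤ ∫⁻ x, F x ^ 2 := setLIntegral_le_lintegral _ _
        _ = ∫⁻ x, ∫⁻ p, g x p.1 * g x p.2 ∂(ν.prod ν) := by
            congr 1 with x
            rw [sq, hF]
            exact (lintegral_prod_mul (hg.comp measurable_prodMk_left).aemeasurable
              (hg.comp measurable_prodMk_left).aemeasurable).symm
        _ = ∫⁻ p, (∫⁻ x, g x p.1 * g x p.2) ∂(ν.prod ν) := by
            rw [lintegral_lintegral_swap]
            refine Measurable.aemeasurable ?_
            have ha : Measurable fun q : ℝ × ℝ × ℝ => (q.1, q.2.1) := by fun_prop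
            have hb : Measurable fun q : ℝ × ℝ × ℝ => (q.1, q.2.2) := by fun_prop
            exact (hg.comp ha).mul (hg.comp hb)
        _ ≤ ∫⁻ p, {p : ℝ × ℝ | |p.1 - p.2| ≤ 2 * η}.indicator
              (fun _ => ENNReal.ofReal (2 * η)) p ∂(ν.prod ν) := by
            refine lintegral_mono fun p => ?_
            by_cases hp : |p.1 - p.2| ≤ 2 * η
            · rw [indicator_of_mem (by exact hp)]
              calc ∫⁻ x, g x p.1 * g x p.2 ≤ ∫⁻ x, (Metric.closedBall p.1 η).indicator 1 x := by
                    refine lintegral_mono fun x => ?_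
                    rw [← hslice p.1]
                    refine mul_le_of_le_one_right zero_le ?_
                    exact indicator_le_self' (s := D) (f := fun _ => (1 : ℝ≥0∞)) (by simp) _
                _ = ENNReal.ofReal (2 * η) := by
                    rw [lintegral_indicator_one Metric.isClosed_closedBall.measurableSet,
                      Real.volume_closedBall]
            · rw [indicator_of_notMem (by exact hp), nonpos_iff_eq_zero]
              refine (lintegral_congr fun x => ?_).trans lintegral_zero
              by_cases hx1 : (x, p.1) ∈ D
              · have hx2 : (x, p.2) ∉ D := by
                  intro hx2
                  apply hp
                  have e1 : |x - p.1| ≤ η := hx1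
                  have e2 : |x - p.2| ≤ η := hx2
                  calc |p.1 - p.2| = |(x - p.2) - (x - p.1)| := by ring_nf
                    _ ≤ |x - p.2| + |x - p.1| := abs_sub _ _
                    _ ≤ 2 * η := by linarith
                simp [g, hx2]
              · simp [g, hx1]
        _ ≤ ENNReal.ofReal (2 * η) * (ν.prod ν) {p | |p.1 - p.2| ≤ 2 * η} :=
            lintegral_indicator_const_le _ _
        _ ≤ _ := by gcongr; exact h _ (by positivity)
    have h3 := sq_lintegral_le (volume.restrict U) hFm.aemeasurable
    rw [Measure.restrict_apply_univ] at h3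
    have hη' : ENNReal.ofReal (2 * η) ≠ 0 := by simp [hη0]
    have hη'' : ENNReal.ofReal (2 * η) ^ 2 ≠ ∞ := ENNReal.pow_ne_top ENNReal.ofReal_ne_top
    refine (ENNReal.mul_le_mul_iff_left (pow_ne_zero 2 hη') hη'').1 ?_
    calc ν K ^ 2 * ENNReal.ofReal (2 * η) ^ 2 = (ν K * ENNReal.ofReal (2 * η)) ^ 2 := by ring
      _ ≤ (∫⁻ x in U, F x) ^ 2 := by gcongr
      _ ≤ _ := h3
      _ ≤ ε * (ENNReal.ofReal (2 * η) * (C * ENNReal.ofReal (2 * η))) := by gcongr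
      _ = _ := by ring
  have hlim : Tendsto (fun ε : ℝ≥0∞ => ε * C) (𝓝[>] 0) (𝓝 0) := by
    have : Tendsto (fun ε : ℝ≥0∞ => ε * C) (𝓝 0) (𝓝 (0 * C)) :=
      ENNReal.Tendsto.mul_const tendsto_id (Or.inr hC)
    rw [zero_mul] at this
    exact this.mono_left nhdsWithin_le_nhds
  have : ν K ^ 2 ≤ 0 := ge_of_tendsto hlim (eventually_nhdsWithin_of_forall key)
  have : ν K = 0 := by simpa using this
  exact hνK.ne' this

/-! ### Mean squares of oscillatory integrals -/

section Phase
variable {Q Z : Type*} [MeasurableSpace Q] [MeasurableSpace Z]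

lemma norm_mul_cexp_I (w : ℂ) (t : ℝ) : ‖w * Complex.exp (Complex.I * t)‖ = ‖w‖ := by
  rw [norm_mul, Complex.norm_exp_I_mul_ofReal, mul_one]

lemma stronglyMeasurable_cexp_phase {φ : Q → Z → ℝ} (hφ : Measurable (Function.uncurry φ)) :
    StronglyMeasurable fun p : Q × Z => Complex.exp (Complex.I * (φ p.1 p.2 : ℂ)) := by
  refine Measurable.stronglyMeasurable ?_
  exact Complex.measurable_exp.comp ((Complex.measurable_ofReal.comp hφ).const_mul _)

/-- Fubini for the mean square of an oscillatory integral. -/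
lemma integral_oscillatory_mul_conj (l : Measure Q) [IsFiniteMeasure l] (m : Measure Z)
    [SFinite m] {h : Z → ℂ} (hh : Integrable h m) {φ : Q → Z → ℝ}
    (hφ : Measurable (Function.uncurry φ)) :
    ∫ q, (∫ z, h z * Complex.exp (Complex.I * φ q z) ∂m) *
        (starRingEnd ℂ) (∫ z, h z * Complex.exp (Complex.I * φ q z) ∂m) ∂l =
      ∫ p : Z × Z, h p.1 * (starRingEnd ℂ) (h p.2) *
        ∫ q, Complex.exp (Complex.I * ((φ q p.1 - φ q p.2 : ℝ) : ℂ)) ∂l ∂(m.prod m) := by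
  have hφ1 : Measurable fun x : Q × Z × Z => φ x.1 x.2.1 :=
    hφ.comp (f := fun x : Q × Z × Z => (x.1, x.2.1)) (by fun_prop)
  have hφ2 : Measurable fun x : Q × Z × Z => φ x.1 x.2.2 :=
    hφ.comp (f := fun x : Q × Z × Z => (x.1, x.2.2)) (by fun_prop)
  have hhh : Integrable (fun p : Z × Z => h p.1 * (starRingEnd ℂ) (h p.2)) (m.prod m) := by
    refine hh.mul_prod (g := fun z => (starRingEnd ℂ) (h z)) ?_
    exact (LinearIsometryEquiv.integrable_comp_iff (Complex.conjLIE)).2 hh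
  calc _ = ∫ q, ∫ p : Z × Z, h p.1 * (starRingEnd ℂ) (h p.2) *
        Complex.exp (Complex.I * ((φ q p.1 - φ q p.2 : ℝ) : ℂ)) ∂(m.prod m) ∂l := by
        congr 1 with q
        rw [← integral_conj, ← integral_prod_mul]
        congr 1 with p
        rw [map_mul, ← Complex.exp_conj, map_mul, Complex.conj_I, Complex.conj_ofReal,
          Complex.ofReal_sub, mul_sub, sub_eq_add_neg, Complex.exp_add]
        ring_nf
    _ = ∫ p : Z × Z, ∫ q, h p.1 * (starRingEnd ℂ) (h p.2) *
        Complex.exp (Complex.I * ((φ q p.1 - φ q p.2 : ℝ) : ℂ)) ∂l ∂(m.prod m) := by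
        refine integral_integral_swap ?_
        have hdom : Integrable (fun x : Q × Z × Z => h x.2.1 * (starRingEnd ℂ) (h x.2.2))
          (l.prod (m.prod m)) := hhh.comp_snd l
        refine hdom.mono ?_ (Eventually.of_forall fun x => ?_)
        · refine hdom.aestronglyMeasurable.mul (Measurable.aestronglyMeasurable ?_)
          exact Complex.measurable_exp.comp
            ((Complex.measurable_ofReal.comp (hφ1.sub hφ2)).const_mul _)
        · exact (norm_mul_cexp_I _ _).le
    _ = _ := by
        congr 1 with p
        rw [integral_const_mul]

lemma norm_oscillatory_le {Q Z : Type*} [MeasurableSpace Z] (m : Measure Z) (h : Z → ℂ)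
    (φ : Q → Z → ℝ) (q : Q) :
    ‖∫ z, h z * Complex.exp (Complex.I * φ q z) ∂m‖ ≤ ∫ z, ‖h z‖ ∂m := by
  refine (norm_integral_le_integral_norm _).trans_eq ?_
  simp_rw [norm_mul_cexp_I]

lemma stronglyMeasurable_oscillatory (m : Measure Z) [SFinite m] {h : Z → ℂ}
    (hh : Measurable h) {φ : Q → Z → ℝ}
    (hφ : Measurable (Function.uncurry φ)) :
    StronglyMeasurable fun q => ∫ z, h z * Complex.exp (Complex.I * φ q z) ∂m := by
  refine StronglyMeasurable.integral_prod_right' (f := fun p : Q × Z =>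
    h p.2 * Complex.exp (Complex.I * φ p.1 p.2)) ?_
  exact (hh.comp measurable_snd).stronglyMeasurable.mul (stronglyMeasurable_cexp_phase hφ)

lemma lintegral_sq_oscillatory (l : Measure Q) [IsFiniteMeasure l] (m : Measure Z)
    [SFinite m] {h : Z → ℂ} (hm : Measurable h) (hh : Integrable h m) {φ : Q → Z → ℝ}
    (hφ : Measurable (Function.uncurry φ)) :
    ∫⁻ q, ‖∫ z, h z * Complex.exp (Complex.I * φ q z) ∂m‖ₑ ^ 2 ∂l =
      ‖∫ p : Z × Z, h p.1 * (starRingEnd ℂ) (h p.2) *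
        ∫ q, Complex.exp (Complex.I * ((φ q p.1 - φ q p.2 : ℝ) : ℂ)) ∂l ∂(m.prod m)‖ₑ := by
  rw [← integral_oscillatory_mul_conj l m hh hφ]
  have hG := stronglyMeasurable_oscillatory m hm hφ
  have e : ∀ q, (∫ z, h z * Complex.exp (Complex.I * φ q z) ∂m) *
      (starRingEnd ℂ) (∫ z, h z * Complex.exp (Complex.I * φ q z) ∂m) =
      ((‖∫ z, h z * Complex.exp (Complex.I * φ q z) ∂m‖ ^ 2 : ℝ) : ℂ) := fun q => by
    rw [Complex.mul_conj, Complex.normSq_eq_norm_sq]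
  simp_rw [e]
  rw [integral_complex_ofReal]
  have hint : Integrable (fun q => ‖∫ z, h z * Complex.exp (Complex.I * φ q z) ∂m‖ ^ 2) l := by
    refine Integrable.of_bound (C := (∫ z, ‖h z‖ ∂m) ^ 2) (hG.norm.pow 2).aestronglyMeasurable
      (Eventually.of_forall fun q => ?_)
    rw [Real.norm_of_nonneg (by positivity)]
    exact pow_le_pow_left₀ (norm_nonneg _) (norm_oscillatory_le m h φ q) 2
  rw [← ofReal_norm, Complex.norm_real, Real.norm_of_nonneg (by positivity),
    ofReal_integral_eq_lintegral_ofReal hint (Eventually.of_forall fun q => by positivity)]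
  congr 1 with q
  rw [ENNReal.ofReal_pow (norm_nonneg _), ofReal_norm]

lemma lintegral_sq_oscillatory_le (l : Measure Q) [IsFiniteMeasure l] (m : Measure Z)
    [SFinite m] {h : Z → ℂ} (hm : Measurable h) (hh : Integrable h m) {φ : Q → Z → ℝ}
    (hφ : Measurable (Function.uncurry φ)) :
    ∫⁻ q, ‖∫ z, h z * Complex.exp (Complex.I * φ q z) ∂m‖ₑ ^ 2 ∂l ≤
      ∫⁻ p : Z × Z, ‖h p.1‖ₑ * ‖h p.2‖ₑ *
        ‖∫ q, Complex.exp (Complex.I * ((φ q p.1 - φ q p.2 : ℝ) : ℂ)) ∂l‖ₑ ∂(m.prod m) := by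
  rw [lintegral_sq_oscillatory l m hm hh hφ]
  refine (enorm_integral_le_lintegral_enorm _).trans_eq ?_
  congr 1 with p
  rw [enorm_mul, enorm_mul, RCLike.enorm_conj]

end Phase

/-! ### Gaussian weights and square-integrable Fourier transforms -/

section Gaussian
variable (V : Type*) [NormedAddCommGroup V] [InnerProductSpace ℝ V] [FiniteDimensional ℝ V]
  [MeasurableSpace V] [BorelSpace V]

/-- The unnormalised Gaussian measure with density `exp (-b ‖q‖²)`. -/
noncomputable def gaussWeight (b : ℝ) : Measure V :=
  (volume : Measure V).withDensity fun q => ENNReal.ofReal (Real.exp (-b * ‖q‖ ^ 2))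

variable {V}

lemma measurable_gaussWeight_density {V : Type*} [NormedAddCommGroup V] [MeasurableSpace V]
    [BorelSpace V] (b : ℝ) :
    Measurable fun q : V => ENNReal.ofReal (Real.exp (-b * ‖q‖ ^ 2)) := by fun_prop

lemma integrable_exp_neg_mul_sq_norm {b : ℝ} (hb : 0 < b) :
    Integrable fun q : V => Real.exp (-b * ‖q‖ ^ 2) := by
  have := (GaussianFourier.integrable_cexp_neg_mul_sq_norm_add (V := V) (b := b)
    (by simpa using hb) 0 0).re
  refine this.congr (Eventually.of_forall fun q => ?_)
  simp [← Complex.ofReal_pow, ← Complex.ofReal_mul, ← Complex.ofReal_neg, Complex.exp_ofReal_re]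

lemma isFiniteMeasure_gaussWeight {b : ℝ} (hb : 0 < b) : IsFiniteMeasure (gaussWeight V b) :=
  isFiniteMeasure_withDensity_ofReal (integrable_exp_neg_mul_sq_norm hb).2

lemma integral_gaussWeight_cexp {b : ℝ} (hb : 0 < b) (w : V) :
    ∫ q, Complex.exp (Complex.I * (inner ℝ w q : ℝ)) ∂(gaussWeight V b) =
      (((Real.pi / b) ^ ((Module.finrank ℝ V : ℝ) / 2) * Real.exp (-‖w‖ ^ 2 / (4 * b)) : ℝ) : ℂ) := by
  rw [gaussWeight, integral_withDensity_eq_integral_toReal_smul (measurable_gaussWeight_density b)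
    (Eventually.of_forall fun _ => ENNReal.ofReal_lt_top)]
  have := GaussianFourier.integral_cexp_neg_mul_sq_norm_add (V := V) (b := b)
    (by simpa using hb) Complex.I w
  calc _ = ∫ v : V, Complex.exp (-b * ‖v‖ ^ 2 + Complex.I * (inner ℝ w v : ℝ)) := by
        congr 1 with q
        rw [ENNReal.toReal_ofReal (Real.exp_pos _).le, Complex.exp_add, Complex.real_smul]
        push_cast; rfl
    _ = _ := by
        rw [this, Complex.ofReal_mul, Complex.ofReal_cpow (by positivity)]
        push_cast
        simp

lemma gaussWeight_univ {b : ℝ} (hb : 0 < b) :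
    gaussWeight V b univ = ENNReal.ofReal ((Real.pi / b) ^ ((Module.finrank ℝ V : ℝ) / 2)) := by
  have := integral_gaussWeight_cexp hb (0 : V)
  have hfin := isFiniteMeasure_gaussWeight (V := V) hb
  simp only [inner_zero_left, Complex.ofReal_zero, mul_zero, Complex.exp_zero, integral_const,
    norm_zero] at this
  have h2 : (gaussWeight V b).real univ = (Real.pi / b) ^ ((Module.finrank ℝ V : ℝ) / 2) := by
    have h3 : (((gaussWeight V b).real univ : ℝ) : ℂ) =
      (((Real.pi / b) ^ ((Module.finrank ℝ V : ℝ) / 2) : ℝ) : ℂ) := by simpa using this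
    exact_mod_cast h3
  rw [← h2, ofReal_measureReal]

/-- If the Fourier transform of a finite measure on `ℝ` is square integrable, the measure is
absolutely continuous. -/
lemma map_absolutelyContinuous_of_lintegral_sq {Z : Type*} [MeasurableSpace Z] (m : Measure Z)
    [IsFiniteMeasure m] {f : Z → ℝ} (hf : Measurable f)
    (h : ∫⁻ τ : ℝ, ‖∫ z, Complex.exp (Complex.I * (τ * f z : ℝ)) ∂m‖ₑ ^ 2 ≠ ∞) :
    m.map f ≪ volume := by
  set A := ∫⁻ τ : ℝ, ‖∫ z, Complex.exp (Complex.I * (τ * f z : ℝ)) ∂m‖ₑ ^ 2 with hA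
  refine absolutelyContinuous_of_prod_le (m.map f) (C := ENNReal.ofReal (Real.exp 4⁻¹) * A)
    (ENNReal.mul_ne_top ENNReal.ofReal_ne_top h) fun δ hδ => ?_
  have hδ2 : 0 < δ ^ 2 := by positivity
  have hfin := isFiniteMeasure_gaussWeight (V := ℝ) hδ2
  have hφ : Measurable (Function.uncurry fun (τ : ℝ) (z : Z) => τ * f z) := by
    exact measurable_fst.mul (hf.comp measurable_snd)
  -- The weight exp(-δ²τ²) is at most 1, so the weighted mean square is at most `A`. Its Fourier
  -- transform is positive and at least of order 1/δ where `|f p.1 - f p.2| ≤ δ`, which bounds the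
  -- correlation by a multiple of δ.
  have key := lintegral_sq_oscillatory (gaussWeight ℝ (δ ^ 2)) m (h := fun _ => 1)
    measurable_const (integrable_const 1) hφ
  simp only [one_mul, map_one] at key
  have hinner : ∀ p : Z × Z, ∫ q : ℝ, Complex.exp (Complex.I * ((q * f p.1 - q * f p.2 : ℝ) : ℂ))
      ∂(gaussWeight ℝ (δ ^ 2)) =
      ((Real.sqrt Real.pi / δ * Real.exp (-(f p.1 - f p.2) ^ 2 / (4 * δ ^ 2)) : ℝ) : ℂ) := by
    intro p
    have := integral_gaussWeight_cexp hδ2 (f p.1 - f p.2)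
    rw [Module.finrank_self, Nat.cast_one, ← Real.sqrt_eq_rpow, Real.sqrt_div Real.pi_pos.le,
      Real.sqrt_sq hδ.le, Real.norm_eq_abs, sq_abs] at this
    rw [← this]
    congr 1 with q
    congr 3
    simp only [RCLike.inner_apply, conj_trivial]
    ring
  simp_rw [hinner] at key
  rw [integral_complex_ofReal, ← ofReal_norm, Complex.norm_real, ofReal_norm] at key
  have hLHS : ∫⁻ q : ℝ, ‖∫ z, Complex.exp (Complex.I * ((q * f z : ℝ) : ℂ)) ∂m‖ₑ ^ 2
      ∂(gaussWeight ℝ (δ ^ 2)) ≤ A := by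
    rw [hA]
    refine lintegral_mono' ?_ le_rfl
    rw [gaussWeight]
    conv_rhs => rw [← withDensity_one (μ := (volume : Measure ℝ))]
    refine withDensity_mono (Eventually.of_forall fun q => ?_)
    rw [Pi.one_apply, ENNReal.ofReal_le_one]
    exact Real.exp_le_one_iff.2 (by nlinarith [norm_nonneg q, sq_nonneg ‖q‖])
  rw [key, Real.enorm_of_nonneg (integral_nonneg fun p => by positivity)] at hLHS
  have hDm : MeasurableSet {p : ℝ × ℝ | |p.1 - p.2| ≤ δ} := by
    refine measurableSet_le ?_ measurable_const
    fun_prop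
  rw [Measure.map_prod_map m m hf hf, Measure.map_apply (hf.prodMap hf) hDm]
  set D : Set (Z × Z) := Prod.map f f ⁻¹' {p : ℝ × ℝ | |p.1 - p.2| ≤ δ} with hD
  have hDm' : MeasurableSet D := (hf.prodMap hf) hDm
  have hlow : ((m.prod m).real D) * (Real.exp (-4⁻¹) / δ) ≤
      ∫ p : Z × Z, Real.sqrt Real.pi / δ * Real.exp (-(f p.1 - f p.2) ^ 2 / (4 * δ ^ 2))
        ∂(m.prod m) := by
    rw [← smul_eq_mul, ← integral_indicator_const _ hDm']
    refine integral_mono ((integrable_const _).indicator hDm') ?_ fun p => ?_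
    · refine Integrable.of_bound (C := Real.sqrt Real.pi / δ) ?_ (Eventually.of_forall fun p => ?_)
      · refine Measurable.aestronglyMeasurable ?_
        have h1 : Measurable fun p : Z × Z => f p.1 := hf.comp measurable_fst
        have h2 : Measurable fun p : Z × Z => f p.2 := hf.comp measurable_snd
        fun_prop
      · rw [Real.norm_of_nonneg (by positivity)]
        refine mul_le_of_le_one_right (by positivity) (Real.exp_le_one_iff.2 ?_)
        rw [neg_div]
        exact neg_nonpos.2 (by positivity)
    · by_cases hp : p ∈ D
      · rw [indicator_of_mem hp]
        have hp' : |f p.1 - f p.2| ≤ δ := hp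
        have hpi : 1 ≤ Real.sqrt Real.pi := Real.one_le_sqrt.2 (by linarith [Real.pi_gt_three])
        have hexp : Real.exp (-4⁻¹) ≤ Real.exp (-(f p.1 - f p.2) ^ 2 / (4 * δ ^ 2)) := by
          refine Real.exp_le_exp.2 ?_
          rw [neg_div, neg_le_neg_iff, div_le_iff₀ (by positivity)]
          have := sq_le_sq' (by linarith [(abs_le.1 hp').1]) (abs_le.1 hp').2
          linarith
        calc Real.exp (-4⁻¹) / δ = 1 / δ * Real.exp (-4⁻¹) := by ring
          _ ≤ _ := by gcongr
      · rw [indicator_of_notMem hp]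
        positivity
  have h1 := (ENNReal.ofReal_le_ofReal hlow).trans hLHS
  rw [ENNReal.ofReal_mul measureReal_nonneg, ofReal_measureReal] at h1
  calc (m.prod m) D = (m.prod m) D * ENNReal.ofReal (Real.exp (-4⁻¹) / δ) *
        ENNReal.ofReal (Real.exp 4⁻¹ * δ) := by
        rw [mul_assoc, ← ENNReal.ofReal_mul (by positivity)]
        have : Real.exp (-4⁻¹) / δ * (Real.exp 4⁻¹ * δ) = 1 := by
          rw [Real.exp_neg]; field_simp
        rw [this, ENNReal.ofReal_one, mul_one]
    _ ≤ A * ENNReal.ofReal (Real.exp 4⁻¹ * δ) := by gcongr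
    _ = _ := by
        rw [ENNReal.ofReal_mul (by positivity)]
        ring
end Gaussian

/-! ### Absolute continuity of almost every projection -/

section Projection
variable {V : Type*} [NormedAddCommGroup V] [InnerProductSpace ℝ V] [FiniteDimensional ℝ V]
  [MeasurableSpace V] [BorelSpace V] {Z : Type*} [MeasurableSpace Z]

lemma measurable_inner_phase {v : Z → V} (hv : Measurable v) :
    Measurable (Function.uncurry fun (q : V) (z : Z) => (inner ℝ (v z) q : ℝ)) :=
  (hv.comp measurable_snd).inner measurable_fst

/-- An oscillatory integral with bounded frequencies is controlled by a Gaussian average. -/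
lemma sq_oscillatory_le_lintegral_gauss (m : Measure Z) [SFinite m] {h : Z → ℂ} {v : Z → V}
    (hm : Measurable h) (hv : Measurable v)
    (hint : Integrable (fun z => h z * (Real.exp (‖v z‖ ^ 2 / 2) : ℝ)) m) (p : V) :
    ‖∫ z, h z * Complex.exp (Complex.I * (inner ℝ (v z) p : ℝ)) ∂m‖ₑ ^ 2 ≤
      ∫⁻ q : V, ‖∫ z, h z * (Real.exp (‖v z‖ ^ 2 / 2) : ℝ) *
          Complex.exp (Complex.I * (inner ℝ (v z) q : ℝ)) ∂m‖ₑ ^ 2 *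
        ENNReal.ofReal (Real.exp (-‖q - p‖ ^ 2 / 2)) := by
  -- This factor cancels exactly the damping exp(-‖v‖²/2) produced by averaging against
  -- exp(-‖q‖²/2), so the average of `G` about `p` reproduces the original integral up to the
  -- constant `c`.
  set w : Z → ℂ := fun z => h z * (Real.exp (‖v z‖ ^ 2 / 2) : ℝ) with hw
  have hwm : Measurable w := by fun_prop
  set G : V → ℂ := fun q => ∫ z, w z * Complex.exp (Complex.I * (inner ℝ (v z) q : ℝ)) ∂m with hG
  have hGm : StronglyMeasurable G := stronglyMeasurable_oscillatory m hwm (measurable_inner_phase hv)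
  have hb : (0 : ℝ) < 1 / 2 := by norm_num
  have hfin := isFiniteMeasure_gaussWeight (V := V) hb
  set c : ℝ := (Real.pi / (1 / 2)) ^ ((Module.finrank ℝ V : ℝ) / 2) with hc
  have hc1 : 1 ≤ c := Real.one_le_rpow (by linarith [Real.pi_gt_three]) (by positivity)
  have hconv : ∫ q, G (p + q) ∂(gaussWeight V (1 / 2)) =
      c * ∫ z, h z * Complex.exp (Complex.I * (inner ℝ (v z) p : ℝ)) ∂m := by
    simp only [hG]
    rw [integral_integral_swap]
    · rw [← integral_const_mul]
      congr 1 with z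
      have e : ∀ q, w z * Complex.exp (Complex.I * ((inner ℝ (v z) (p + q) : ℝ) : ℂ)) =
          w z * Complex.exp (Complex.I * ((inner ℝ (v z) p : ℝ) : ℂ)) *
            Complex.exp (Complex.I * ((inner ℝ (v z) q : ℝ) : ℂ)) := fun q => by
        rw [inner_add_right, Complex.ofReal_add, mul_add, Complex.exp_add]; ring
      simp_rw [e]
      rw [integral_const_mul, integral_gaussWeight_cexp hb, ← hc, hw]
      have e2 : ((Real.exp (‖v z‖ ^ 2 / 2) : ℝ) : ℂ) *
          ((Real.exp (-‖v z‖ ^ 2 / (4 * (1 / 2))) : ℝ) : ℂ) = 1 := by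
        rw [← Complex.ofReal_mul, ← Real.exp_add,
          show ‖v z‖ ^ 2 / 2 + -‖v z‖ ^ 2 / (4 * (1 / 2)) = 0 by ring, Real.exp_zero,
          Complex.ofReal_one]
      rw [Complex.ofReal_mul]
      linear_combination (h z * Complex.exp (Complex.I * ((inner ℝ (v z) p : ℝ) : ℂ)) * c) * e2
    · have hdom : Integrable (fun x : V × Z => w x.2) ((gaussWeight V (1 / 2)).prod m) :=
        hint.comp_snd _
      refine hdom.mono ?_ (Eventually.of_forall fun x => (norm_mul_cexp_I _ _).le)
      refine hdom.aestronglyMeasurable.mul (Measurable.aestronglyMeasurable ?_)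
      refine Complex.measurable_exp.comp ((Complex.measurable_ofReal.comp ?_).const_mul _)
      exact (hv.comp measurable_snd).inner (measurable_fst.const_add p)
  set F : ℂ := ∫ z, h z * Complex.exp (Complex.I * (inner ℝ (v z) p : ℝ)) ∂m with hF
  have hGp : Measurable fun q => ‖G (p + q)‖ₑ :=
    (hGm.measurable.comp (measurable_const_add p)).enorm
  have h1 : ENNReal.ofReal c * ‖F‖ₑ ≤ ∫⁻ q, ‖G (p + q)‖ₑ ∂(gaussWeight V (1 / 2)) := by
    refine le_trans (le_of_eq ?_) (enorm_integral_le_lintegral_enorm _)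
    rw [hconv, enorm_mul, ← ofReal_norm (c : ℂ), Complex.norm_real,
      Real.norm_of_nonneg (by linarith)]
  have h2 := sq_lintegral_le (gaussWeight V (1 / 2)) hGp.aemeasurable
  rw [gaussWeight_univ hb, ← hc] at h2
  have h3 : ‖F‖ₑ ^ 2 ≤ ∫⁻ q, ‖G (p + q)‖ₑ ^ 2 ∂(gaussWeight V (1 / 2)) := by
    have hc0 : ENNReal.ofReal c ≠ 0 := by simp; linarith
    refine (ENNReal.mul_le_mul_iff_right hc0 ENNReal.ofReal_ne_top).1 ?_
    calc ENNReal.ofReal c * ‖F‖ₑ ^ 2 ≤ ENNReal.ofReal c ^ 2 * ‖F‖ₑ ^ 2 := by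
          gcongr
          exact le_self_pow₀ (ENNReal.one_le_ofReal.2 hc1) two_ne_zero
      _ = (ENNReal.ofReal c * ‖F‖ₑ) ^ 2 := by ring
      _ ≤ _ := (pow_le_pow_left₀ zero_le h1 2).trans h2
  refine h3.trans_eq ?_
  rw [gaussWeight, lintegral_withDensity_eq_lintegral_mul _ (measurable_gaussWeight_density _)
    (hGp.pow_const 2)]
  refine Eq.trans ?_ (lintegral_add_left_eq_self _ p)
  congr 1 with q
  rw [Pi.mul_apply, mul_comm, add_sub_cancel_left]
  congr 3
  ring

/-- The unit Gaussian in q - τx localises x to a ball of radius about 1/R, whose mass is of order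
R^(-s). Half of the exponent is spent on this; the other half, with ‖τx‖ ≤ 2RM, yields decay in q at
scale R. -/
lemma lintegral_exp_neg_sq_sub_smul_le {V : Type*} [NormedAddCommGroup V] [NormedSpace ℝ V]
    [MeasurableSpace V] [BorelSpace V] (μ : Measure V) {s : ℝ} (hs : 0 ≤ s) {C : ℝ≥0∞}
    (hball : ∀ x r, 0 < r → μ (Metric.closedBall x r) ≤ C * ENNReal.ofReal r ^ s) {M : ℝ}
    (hM : ∀ᵐ x ∂μ, ‖x‖ ≤ M) {R τ : ℝ} (hR : 1 ≤ R) (hRτ : R ≤ τ) (hτR : τ ≤ 2 * R) (q : V) :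
    ∫⁻ x, ENNReal.ofReal (Real.exp (-‖q - τ • x‖ ^ 2 / 2)) ∂μ ≤
      gaussTailConst s * C * ENNReal.ofReal (R / 2) ^ (-s) * ENNReal.ofReal (Real.exp (M ^ 2)) *
        ENNReal.ofReal (Real.exp (-(8 * R ^ 2)⁻¹ * ‖q‖ ^ 2)) := by
  have hR0 : 0 < R := by linarith
  have hτ0 : 0 < τ := by linarith
  have hpt : ∀ᵐ x ∂μ, ENNReal.ofReal (Real.exp (-‖q - τ • x‖ ^ 2 / 2)) ≤
      ENNReal.ofReal (Real.exp (-((R / 2) * ‖x - τ⁻¹ • q‖) ^ 2)) *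
        (ENNReal.ofReal (Real.exp (M ^ 2)) *
          ENNReal.ofReal (Real.exp (-(8 * R ^ 2)⁻¹ * ‖q‖ ^ 2))) := by
    filter_upwards [hM] with x hx
    rw [← ENNReal.ofReal_mul (Real.exp_pos _).le, ← ENNReal.ofReal_mul (Real.exp_pos _).le,
      ← Real.exp_add, ← Real.exp_add]
    refine ENNReal.ofReal_le_ofReal (Real.exp_le_exp.2 ?_)
    set D := ‖q - τ • x‖ with hD
    have hD0 : 0 ≤ D := norm_nonneg _
    have e1 : τ * ‖x - τ⁻¹ • q‖ = D := by
      rw [hD, norm_sub_rev q, ← Real.norm_of_nonneg hτ0.le, ← norm_smul, smul_sub, smul_smul,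
        Real.norm_of_nonneg hτ0.le, mul_inv_cancel₀ hτ0.ne', one_smul]
    have e2 : ((R / 2) * ‖x - τ⁻¹ • q‖) ^ 2 ≤ D ^ 2 / 4 := by
      have : (R * ‖x - τ⁻¹ • q‖) ^ 2 ≤ D ^ 2 := by
        rw [← e1]; gcongr
      nlinarith
    have e3 : ‖q‖ ≤ D + 2 * R * M := by
      calc ‖q‖ = ‖(q - τ • x) + τ • x‖ := by rw [sub_add_cancel]
        _ ≤ D + ‖τ • x‖ := norm_add_le _ _
        _ ≤ D + 2 * R * M := by
          rw [norm_smul, Real.norm_of_nonneg hτ0.le]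
          gcongr
    have e4 : ‖q‖ ^ 2 ≤ 2 * D ^ 2 + 8 * R ^ 2 * M ^ 2 := by
      have := pow_le_pow_left₀ (norm_nonneg q) e3 2
      nlinarith [sq_nonneg (D - 2 * R * M)]
    have e5 : (8 * R ^ 2)⁻¹ * ‖q‖ ^ 2 ≤ D ^ 2 / 4 + M ^ 2 := by
      rw [inv_mul_le_iff₀ (by positivity)]
      have : D ^ 2 ≤ R ^ 2 * D ^ 2 :=
        le_mul_of_one_le_left (by positivity) (one_le_pow₀ hR)
      nlinarith
    linarith
  have hmeas : Measurable fun x : V => ‖x - τ⁻¹ • q‖ := by fun_prop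
  have htail := lintegral_exp_neg_sq_le hs μ (f := fun x => ‖x - τ⁻¹ • q‖) (C := C) hmeas
    (fun x => norm_nonneg _) (fun r hr => by
      have : {x | ‖x - τ⁻¹ • q‖ ≤ r} = Metric.closedBall (τ⁻¹ • q) r := by
        ext x; simp [dist_eq_norm]
      rw [this]; exact hball _ r hr) (by positivity : 0 < R / 2)
  refine (lintegral_mono_ae hpt).trans ?_
  rw [lintegral_mul_const _ (by fun_prop)]
  calc _ ≤ gaussTailConst s * C * ENNReal.ofReal (R / 2) ^ (-s) *
        (ENNReal.ofReal (Real.exp (M ^ 2)) *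
          ENNReal.ofReal (Real.exp (-(8 * R ^ 2)⁻¹ * ‖q‖ ^ 2))) := by gcongr
    _ = _ := by ring

/-- The Fourier transform at `τ` of the law of `u + ⟪v, x⟫`. -/
noncomputable def projFourier (m : Measure Z) (u : Z → ℝ) (v : Z → V) (τ : ℝ) (x : V) : ℂ :=
  ∫ z, Complex.exp (Complex.I * (τ * (u z + inner ℝ (v z) x) : ℝ)) ∂m

lemma measurable_projFourier (m : Measure Z) [SFinite m] {u : Z → ℝ} {v : Z → V}
    (hu : Measurable u) (hv : Measurable v) :
    Measurable (Function.uncurry fun (x : V) (τ : ℝ) => projFourier m u v τ x) := by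
  have hφ : Measurable (Function.uncurry fun (q : V × ℝ) (z : Z) =>
      q.2 * (u z + inner ℝ (v z) q.1)) := by
    refine Measurable.mul (by fun_prop) (Measurable.add (by fun_prop) ?_)
    exact (hv.comp measurable_snd).inner (by fun_prop)
  have := (stronglyMeasurable_oscillatory m (h := fun _ => 1) measurable_const hφ).measurable
  simpa only [one_mul, projFourier, Function.uncurry_def] using this

variable {m : Measure Z} [IsFiniteMeasure m] {u : Z → ℝ} {v : Z → V}

/-- This is the energy of the law of (u, v) at frequencies up to about R. After squaring and Fubini,
the Gaussian cutoffs become R^(d+1) times a Gaussian of width about 1/R in the differences of u and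
v, which the correlation hypothesis bounds by R^(-a). -/
lemma lintegral_sq_weighted_oscillatory_le (hu : Measurable u) (hv : Measurable v) {N : ℝ}
    (hN : ∀ᵐ z ∂m, ‖v z‖ ≤ N) {a : ℝ} (ha : 0 ≤ a) {C : ℝ≥0∞}
    (hcorr : ∀ r, 0 < r → (m.prod m) {p | |u p.1 - u p.2| ≤ r ∧ ‖v p.1 - v p.2‖ ≤ r} ≤
      C * ENNReal.ofReal r ^ a) {R : ℝ} (hR : 0 < R) :
    ∫⁻ τ in Icc R (2 * R), (∫⁻ q, ‖∫ z, ((Real.exp (‖v z‖ ^ 2 / 2) : ℝ) : ℂ) *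
        Complex.exp (Complex.I * (τ * u z + inner ℝ (v z) q : ℝ)) ∂m‖ₑ ^ 2
          ∂(gaussWeight V (8 * R ^ 2)⁻¹)) ≤
      ENNReal.ofReal (Real.exp 4 * Real.exp (N ^ 2) * (Real.sqrt Real.pi *
        (8 * Real.pi) ^ ((Module.finrank ℝ V : ℝ) / 2) * R ^ (Module.finrank ℝ V + 1))) *
        (gaussTailConst a * C * ENNReal.ofReal (R / 2) ^ (-a)) := by
  have hb1 : 0 < (8 * R ^ 2)⁻¹ := by positivity
  have hb2 : 0 < (R ^ 2)⁻¹ := by positivity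
  have hfin1 := isFiniteMeasure_gaussWeight (V := V) hb1
  have hfin2 := isFiniteMeasure_gaussWeight (V := ℝ) hb2
  set w : Z → ℂ := fun z => ((Real.exp (‖v z‖ ^ 2 / 2) : ℝ) : ℂ) with hw
  have hwm : Measurable w := by fun_prop
  have hwN : ∀ᵐ z ∂m, ‖w z‖ ≤ Real.exp (N ^ 2 / 2) := by
    filter_upwards [hN] with z hz
    rw [hw, Complex.norm_real, Real.norm_of_nonneg (Real.exp_pos _).le]
    gcongr
  have hwi : Integrable w m := Integrable.of_bound hwm.aestronglyMeasurable _ hwN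
  let φ : ℝ × V → Z → ℝ := fun q z => q.1 * u z + inner ℝ (v z) q.2
  have hφ : Measurable (Function.uncurry φ) := by
    refine Measurable.add (by fun_prop) ?_
    exact (hv.comp measurable_snd).inner (by fun_prop)
  have hGm := (stronglyMeasurable_oscillatory m hwm hφ).measurable.enorm.pow_const 2
  set g : ℝ × V → ℝ≥0∞ := fun q => ‖∫ z, w z * Complex.exp (Complex.I * φ q z) ∂m‖ₑ ^ 2 with hg
  set ρ : Z × Z → ℝ := fun p => Real.sqrt ((u p.1 - u p.2) ^ 2 + ‖v p.1 - v p.2‖ ^ 2) with hρ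
  have hρm : Measurable ρ := by
    have h1 : Measurable fun p : Z × Z => v p.1 := hv.comp measurable_fst
    have h2 : Measurable fun p : Z × Z => v p.2 := hv.comp measurable_snd
    have h3 : Measurable fun p : Z × Z => u p.1 := hu.comp measurable_fst
    have h4 : Measurable fun p : Z × Z => u p.2 := hu.comp measurable_snd
    fun_prop
  set K : ℝ := Real.sqrt Real.pi * (8 * Real.pi) ^ ((Module.finrank ℝ V : ℝ) / 2) *
    R ^ (Module.finrank ℝ V + 1) with hK
  have hK0 : 0 ≤ K := by positivity
  have hinner : ∀ p : Z × Z, ‖∫ q, Complex.exp (Complex.I * ((φ q p.1 - φ q p.2 : ℝ) : ℂ))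
      ∂((gaussWeight ℝ (R ^ 2)⁻¹).prod (gaussWeight V (8 * R ^ 2)⁻¹))‖ₑ ≤
      ENNReal.ofReal K * ENNReal.ofReal (Real.exp (-((R / 2) * ρ p) ^ 2)) := by
    intro p
    have e : ∀ q : ℝ × V, Complex.exp (Complex.I * ((φ q p.1 - φ q p.2 : ℝ) : ℂ)) =
        Complex.exp (Complex.I * ((inner ℝ (u p.1 - u p.2) q.1 : ℝ) : ℂ)) *
        Complex.exp (Complex.I * ((inner ℝ (v p.1 - v p.2) q.2 : ℝ) : ℂ)) := by
      intro q
      rw [← Complex.exp_add, ← mul_add, ← Complex.ofReal_add, inner_sub_left (v p.1)]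
      congr 3
      simp only [φ, RCLike.inner_apply, conj_trivial]
      ring
    simp_rw [e]
    rw [integral_prod_mul (fun t : ℝ => Complex.exp (Complex.I * ((inner ℝ (u p.1 - u p.2) t : ℝ) : ℂ)))
      (fun q : V => Complex.exp (Complex.I * ((inner ℝ (v p.1 - v p.2) q : ℝ) : ℂ))),
      integral_gaussWeight_cexp hb1, integral_gaussWeight_cexp hb2, ← Complex.ofReal_mul,
      ← ofReal_norm, Complex.norm_real, Real.norm_of_nonneg (by positivity),
      ← ENNReal.ofReal_mul hK0]
    refine ENNReal.ofReal_le_ofReal ?_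
    have r1 : (Real.pi / (R ^ 2)⁻¹) ^ ((Module.finrank ℝ ℝ : ℝ) / 2) = Real.sqrt Real.pi * R := by
      rw [Module.finrank_self, Nat.cast_one, ← Real.sqrt_eq_rpow, div_inv_eq_mul,
        Real.sqrt_mul Real.pi_pos.le, Real.sqrt_sq hR.le]
    have r2 : (Real.pi / (8 * R ^ 2)⁻¹) ^ ((Module.finrank ℝ V : ℝ) / 2) =
        (8 * Real.pi) ^ ((Module.finrank ℝ V : ℝ) / 2) * R ^ (Module.finrank ℝ V) := by
      rw [div_inv_eq_mul, show Real.pi * (8 * R ^ 2) = (8 * Real.pi) * R ^ 2 by ring,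
        Real.mul_rpow (by positivity) (by positivity), ← Real.rpow_natCast R 2, ← Real.rpow_mul hR.le,
        ← Real.rpow_natCast R (Module.finrank ℝ V)]
      congr 2
      push_cast; ring
    rw [r1, r2]
    calc _ = K * (Real.exp (-‖u p.1 - u p.2‖ ^ 2 / (4 * (R ^ 2)⁻¹)) *
          Real.exp (-‖v p.1 - v p.2‖ ^ 2 / (4 * (8 * R ^ 2)⁻¹))) := by rw [hK]; ring
      _ ≤ _ := by
        gcongr
        rw [← Real.exp_add]
        refine Real.exp_le_exp.2 ?_
        rw [mul_pow, hρ, Real.sq_sqrt (by positivity), Real.norm_eq_abs, sq_abs]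
        have : 0 ≤ R ^ 2 * ‖v p.1 - v p.2‖ ^ 2 := by positivity
        field_simp
        nlinarith
  calc ∫⁻ τ in Icc R (2 * R), (∫⁻ q, g (τ, q) ∂(gaussWeight V (8 * R ^ 2)⁻¹))
      -- On this interval (τ/R)² ≤ 4, so a Gaussian cutoff can be inserted at the cost of exp 4.
      ≤ ∫⁻ τ in Icc R (2 * R), ENNReal.ofReal (Real.exp 4) *
          (ENNReal.ofReal (Real.exp (-(R ^ 2)⁻¹ * ‖τ‖ ^ 2)) *
            ∫⁻ q, g (τ, q) ∂(gaussWeight V (8 * R ^ 2)⁻¹)) := by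
        refine setLIntegral_mono' measurableSet_Icc fun τ hτ => ?_
        rw [← mul_assoc, ← ENNReal.ofReal_mul (Real.exp_pos _).le, ← Real.exp_add]
        refine le_mul_of_one_le_left zero_le (ENNReal.one_le_ofReal.2 (Real.one_le_exp ?_))
        have h1 : ‖τ‖ ^ 2 ≤ (2 * R) ^ 2 := by
          rw [Real.norm_of_nonneg (by linarith [hτ.1])]
          exact pow_le_pow_left₀ (by linarith [hτ.1]) hτ.2 2
        have h2 : (R ^ 2)⁻¹ * ‖τ‖ ^ 2 ≤ 4 := by
          rw [inv_mul_le_iff₀ (by positivity)]; linarith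
        linarith
    _ ≤ ∫⁻ τ, ENNReal.ofReal (Real.exp 4) *
          (ENNReal.ofReal (Real.exp (-(R ^ 2)⁻¹ * ‖τ‖ ^ 2)) *
            ∫⁻ q, g (τ, q) ∂(gaussWeight V (8 * R ^ 2)⁻¹)) := setLIntegral_le_lintegral _ _
    _ = ENNReal.ofReal (Real.exp 4) * ∫⁻ τ, (∫⁻ q, g (τ, q) ∂(gaussWeight V (8 * R ^ 2)⁻¹))
          ∂(gaussWeight ℝ (R ^ 2)⁻¹) := by
        rw [lintegral_const_mul' _ _ ENNReal.ofReal_ne_top, gaussWeight, gaussWeight,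
          lintegral_withDensity_eq_lintegral_mul _ (measurable_gaussWeight_density _)]
        · rfl
        · exact hGm.lintegral_prod_right'
    _ = ENNReal.ofReal (Real.exp 4) * ∫⁻ q, g q
          ∂((gaussWeight ℝ (R ^ 2)⁻¹).prod (gaussWeight V (8 * R ^ 2)⁻¹)) := by
        rw [lintegral_prod _ hGm.aemeasurable]
    _ ≤ ENNReal.ofReal (Real.exp 4) * ∫⁻ p : Z × Z, ENNReal.ofReal (Real.exp (N ^ 2)) *
          ENNReal.ofReal K * ENNReal.ofReal (Real.exp (-((R / 2) * ρ p) ^ 2)) ∂(m.prod m) := by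
        gcongr
        refine (lintegral_sq_oscillatory_le _ m hwm hwi hφ).trans (lintegral_mono_ae ?_)
        have hN1 : ∀ᵐ p ∂(m.prod m), ‖w p.1‖ ≤ Real.exp (N ^ 2 / 2) :=
          Measure.quasiMeasurePreserving_fst.ae hwN
        have hN2 : ∀ᵐ p ∂(m.prod m), ‖w p.2‖ ≤ Real.exp (N ^ 2 / 2) :=
          Measure.quasiMeasurePreserving_snd.ae hwN
        filter_upwards [hN1, hN2] with p hp1 hp2
        rw [mul_assoc (ENNReal.ofReal (Real.exp (N ^ 2)))]
        refine mul_le_mul' ?_ (hinner p)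
        rw [← ofReal_norm, ← ofReal_norm, ← ENNReal.ofReal_mul (norm_nonneg _)]
        refine ENNReal.ofReal_le_ofReal ((mul_le_mul hp1 hp2 (norm_nonneg _)
          (Real.exp_pos _).le).trans_eq ?_)
        rw [← Real.exp_add, add_halves]
    _ ≤ ENNReal.ofReal (Real.exp 4) * (ENNReal.ofReal (Real.exp (N ^ 2)) * ENNReal.ofReal K *
          (gaussTailConst a * C * ENNReal.ofReal (R / 2) ^ (-a))) := by
        rw [lintegral_const_mul' _ _ (ENNReal.mul_ne_top ENNReal.ofReal_ne_top ENNReal.ofReal_ne_top)]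
        gcongr
        refine lintegral_exp_neg_sq_le ha (m.prod m) hρm (fun p => Real.sqrt_nonneg _)
          (fun r hr => (measure_mono fun p hp => ?_).trans (hcorr r hr)) (by positivity)
        have h1 : (u p.1 - u p.2) ^ 2 + ‖v p.1 - v p.2‖ ^ 2 ≤ r ^ 2 :=
          (Real.sqrt_le_left hr.le).1 hp
        exact ⟨abs_le_of_sq_le_sq (by nlinarith [sq_nonneg ‖v p.1 - v p.2‖]) hr.le,
          (pow_le_pow_iff_left₀ (norm_nonneg _) hr.le two_ne_zero).1
            (by nlinarith [sq_nonneg (u p.1 - u p.2)])⟩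
    _ = _ := by
        rw [ENNReal.ofReal_mul (p := Real.exp 4 * Real.exp (N ^ 2)) (by positivity),
          ENNReal.ofReal_mul (p := Real.exp 4) (by positivity)]
        ring
end Projection

lemma Measurable.uncurry_setLIntegral {α β : Type*} [MeasurableSpace α] [MeasurableSpace β]
    {ν : Measure β} [SFinite ν] {g : α → β → ℝ≥0∞} (h : Measurable (Function.uncurry g))
    (S : Set β) : Measurable fun x => ∫⁻ τ in S, g x τ ∂ν :=
  h.lintegral_prod_right

lemma Measurable.uncurry_lintegral {α β : Type*} [MeasurableSpace α] [MeasurableSpace β]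
    {ν : Measure β} [SFinite ν] {g : α → β → ℝ≥0∞} (h : Measurable (Function.uncurry g)) :
    Measurable fun x => ∫⁻ τ, g x τ ∂ν :=
  h.lintegral_prod_right

section Projection
variable {V : Type*} [NormedAddCommGroup V] [InnerProductSpace ℝ V] [FiniteDimensional ℝ V]
  [MeasurableSpace V] [BorelSpace V] {Z : Type*} [MeasurableSpace Z]
  {m : Measure Z} [IsFiniteMeasure m] {u : Z → ℝ} {v : Z → V}

lemma measurable_sq_projFourier (hu : Measurable u) (hv : Measurable v) :
    Measurable (Function.uncurry fun x τ => ‖projFourier m u v τ x‖ₑ ^ 2) := by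
  have h : Measurable fun p : V × ℝ => projFourier m u v p.2 p.1 := measurable_projFourier m hu hv
  have h2 : Measurable fun p : V × ℝ => ‖projFourier m u v p.2 p.1‖ₑ ^ 2 := h.enorm.pow_const 2
  exact h2

/-- The contribution of frequencies of size about `R` to the mean square of `projFourier`. -/
lemma lintegral_sq_projFourier_Icc_le (hu : Measurable u) (hv : Measurable v) {N : ℝ}
    (hN : ∀ᵐ z ∂m, ‖v z‖ ≤ N) {a : ℝ} (ha : 0 ≤ a) {C : ℝ≥0∞}
    (hcorr : ∀ r, 0 < r → (m.prod m) {p | |u p.1 - u p.2| ≤ r ∧ ‖v p.1 - v p.2‖ ≤ r} ≤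
      C * ENNReal.ofReal r ^ a) (hC : C ≠ ∞)
    (μ : Measure V) [IsFiniteMeasure μ] {s : ℝ} (hs : 0 ≤ s) {D : ℝ≥0∞} (hD : D ≠ ∞)
    (hball : ∀ x r, 0 < r → μ (Metric.closedBall x r) ≤ D * ENNReal.ofReal r ^ s) {M : ℝ}
    (hM : ∀ᵐ x ∂μ, ‖x‖ ≤ M) :
    ∃ K : ℝ≥0∞, K ≠ ∞ ∧ ∀ R : ℝ, 1 ≤ R →
      ∫⁻ x, (∫⁻ τ in Icc R (2 * R), ‖projFourier m u v τ x‖ₑ ^ 2) ∂μ ≤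
        K * ENNReal.ofReal R ^ ((Module.finrank ℝ V : ℝ) + 1 - s - a) := by
  set d := Module.finrank ℝ V with hd
  refine ⟨gaussTailConst s * D * ENNReal.ofReal (1 / 2) ^ (-s) * ENNReal.ofReal (Real.exp (M ^ 2)) *
    (ENNReal.ofReal (Real.exp 4 * Real.exp (N ^ 2) * (Real.sqrt Real.pi *
        (8 * Real.pi) ^ ((d : ℝ) / 2))) *
      (gaussTailConst a * C * ENNReal.ofReal (1 / 2) ^ (-a))), ?_, fun R hR => ?_⟩
  · have hhalf : ∀ t : ℝ, ENNReal.ofReal (1 / 2) ^ t ≠ ∞ := fun t => by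
      rw [ENNReal.ofReal_rpow_of_pos (by norm_num)]; exact ENNReal.ofReal_ne_top
    exact ENNReal.mul_ne_top (ENNReal.mul_ne_top (ENNReal.mul_ne_top
      (ENNReal.mul_ne_top (gaussTailConst_ne_top s) hD) (hhalf _)) ENNReal.ofReal_ne_top)
      (ENNReal.mul_ne_top ENNReal.ofReal_ne_top
        (ENNReal.mul_ne_top (ENNReal.mul_ne_top (gaussTailConst_ne_top a) hC) (hhalf _)))
  have hR0 : 0 < R := by linarith
  set B := gaussTailConst s * D * ENNReal.ofReal (R / 2) ^ (-s) * ENNReal.ofReal (Real.exp (M ^ 2))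
    with hB
  have hφ : Measurable (Function.uncurry fun (q : ℝ × V) (z : Z) => q.1 * u z + inner ℝ (v z) q.2) := by
    refine Measurable.add (by fun_prop) ?_
    exact (hv.comp measurable_snd).inner (by fun_prop)
  have hwm : Measurable fun z => ((Real.exp (‖v z‖ ^ 2 / 2) : ℝ) : ℂ) := by fun_prop
  set g : ℝ → V → ℝ≥0∞ := fun τ q => ‖∫ z, ((Real.exp (‖v z‖ ^ 2 / 2) : ℝ) : ℂ) *
        Complex.exp (Complex.I * (τ * u z + inner ℝ (v z) q : ℝ)) ∂m‖ₑ ^ 2 with hg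
  have hgm : Measurable (Function.uncurry g) :=
    (stronglyMeasurable_oscillatory m hwm hφ).measurable.enorm.pow_const 2
  have hgτ : ∀ τ, Measurable (g τ) := fun τ => hgm.of_uncurry_left
  -- The phase exp(iτu) is absorbed into the amplitude, leaving an oscillatory integral in `v`
  -- evaluated at the point `τ • x`.
  have hpoint : ∀ τ x, ‖projFourier m u v τ x‖ₑ ^ 2 ≤
      ∫⁻ q : V, g τ q * ENNReal.ofReal (Real.exp (-‖q - τ • x‖ ^ 2 / 2)) := by
    intro τ x
    have hhm : Measurable fun z => Complex.exp (Complex.I * (τ * u z : ℝ)) := by fun_prop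
    have hint : Integrable (fun z => Complex.exp (Complex.I * (τ * u z : ℝ)) *
        ((Real.exp (‖v z‖ ^ 2 / 2) : ℝ) : ℂ)) m := by
      refine Integrable.of_bound (C := Real.exp (N ^ 2 / 2)) (hhm.mul hwm).aestronglyMeasurable ?_
      filter_upwards [hN] with z hz
      rw [mul_comm, norm_mul_cexp_I, Complex.norm_real, Real.norm_of_nonneg (Real.exp_pos _).le]
      gcongr
    have h := sq_oscillatory_le_lintegral_gauss m hhm hv hint (τ • x)
    have e1 : projFourier m u v τ x = ∫ z, Complex.exp (Complex.I * (τ * u z : ℝ)) *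
        Complex.exp (Complex.I * (inner ℝ (v z) (τ • x) : ℝ)) ∂m := by
      unfold projFourier
      congr 1 with z
      rw [← Complex.exp_add, ← mul_add, ← Complex.ofReal_add, inner_smul_right, mul_add]
    rw [e1]
    refine h.trans_eq ?_
    congr 1 with q
    congr 4 with z
    rw [mul_right_comm, ← Complex.exp_add, ← mul_add, ← Complex.ofReal_add, mul_comm]
  calc ∫⁻ x, (∫⁻ τ in Icc R (2 * R), ‖projFourier m u v τ x‖ₑ ^ 2) ∂μ
      = ∫⁻ τ in Icc R (2 * R), (∫⁻ x, ‖projFourier m u v τ x‖ₑ ^ 2 ∂μ) :=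
        lintegral_lintegral_swap (measurable_sq_projFourier hu hv).aemeasurable
    _ ≤ ∫⁻ τ in Icc R (2 * R), B * ∫⁻ q, g τ q ∂(gaussWeight V (8 * R ^ 2)⁻¹) := by
        refine setLIntegral_mono' measurableSet_Icc fun τ hτ => ?_
        calc ∫⁻ x, ‖projFourier m u v τ x‖ₑ ^ 2 ∂μ
            ≤ ∫⁻ x, (∫⁻ q : V, g τ q * ENNReal.ofReal (Real.exp (-‖q - τ • x‖ ^ 2 / 2))) ∂μ :=
              lintegral_mono fun x => hpoint τ x
          _ = ∫⁻ q : V, (∫⁻ x, g τ q * ENNReal.ofReal (Real.exp (-‖q - τ • x‖ ^ 2 / 2)) ∂μ) := by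
              refine lintegral_lintegral_swap (Measurable.aemeasurable ?_)
              exact ((hgτ τ).comp measurable_snd).mul (by fun_prop)
          _ ≤ ∫⁻ q : V, B * (ENNReal.ofReal (Real.exp (-(8 * R ^ 2)⁻¹ * ‖q‖ ^ 2)) * g τ q) := by
              refine lintegral_mono fun q => ?_
              rw [lintegral_const_mul _ (by fun_prop)]
              calc _ ≤ g τ q * (B * ENNReal.ofReal (Real.exp (-(8 * R ^ 2)⁻¹ * ‖q‖ ^ 2))) := by
                    gcongr
                    exact lintegral_exp_neg_sq_sub_smul_le μ hs hball hM hR hτ.1 hτ.2 q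
                _ = _ := by ring
          _ = B * ∫⁻ q, g τ q ∂(gaussWeight V (8 * R ^ 2)⁻¹) := by
              rw [gaussWeight,
                lintegral_withDensity_eq_lintegral_mul _ (measurable_gaussWeight_density _) (hgτ τ)]
              exact lintegral_const_mul _ ((measurable_gaussWeight_density _).mul (hgτ τ))
    _ = B * ∫⁻ τ in Icc R (2 * R), (∫⁻ q, g τ q ∂(gaussWeight V (8 * R ^ 2)⁻¹)) := by
        have hfin := isFiniteMeasure_gaussWeight (V := V) (by positivity : 0 < (8 * R ^ 2)⁻¹)
        rw [lintegral_const_mul _ hgm.uncurry_lintegral]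
    _ ≤ B * (ENNReal.ofReal (Real.exp 4 * Real.exp (N ^ 2) * (Real.sqrt Real.pi *
        (8 * Real.pi) ^ ((d : ℝ) / 2) * R ^ (d + 1))) *
        (gaussTailConst a * C * ENNReal.ofReal (R / 2) ^ (-a))) := by
        gcongr
        exact lintegral_sq_weighted_oscillatory_le hu hv hN ha hcorr hR0
    _ = _ := by
        have hsplit : ∀ t : ℝ, ENNReal.ofReal (R / 2) ^ t =
            ENNReal.ofReal R ^ t * ENNReal.ofReal (1 / 2) ^ t := fun t => by
          rw [ENNReal.ofReal_rpow_of_pos (by positivity), ENNReal.ofReal_rpow_of_pos hR0,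
            ENNReal.ofReal_rpow_of_pos (by norm_num), ← ENNReal.ofReal_mul (by positivity),
            ← Real.mul_rpow hR0.le (by norm_num), mul_one_div]
        have hpow : ENNReal.ofReal R ^ ((d : ℝ) + 1 - s - a) =
            ENNReal.ofReal R ^ (-s) * ENNReal.ofReal (R ^ (d + 1)) * ENNReal.ofReal R ^ (-a) := by
          rw [ENNReal.ofReal_rpow_of_pos hR0, ENNReal.ofReal_rpow_of_pos hR0,
            ENNReal.ofReal_rpow_of_pos hR0, ← ENNReal.ofReal_mul (by positivity),
            ← ENNReal.ofReal_mul (by positivity), ← Real.rpow_natCast R (d + 1),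
            ← Real.rpow_add hR0, ← Real.rpow_add hR0]
          congr 2; push_cast; ring
        rw [hB, hsplit, hsplit, hpow, ← mul_assoc (Real.exp 4 * Real.exp (N ^ 2)),
          ENNReal.ofReal_mul (by positivity)]
        ring

lemma enorm_projFourier_neg {V : Type*} [NormedAddCommGroup V] [InnerProductSpace ℝ V] (m : Measure Z)
    (u : Z → ℝ) (v : Z → V) (τ : ℝ) (x : V) :
    ‖projFourier m u v (-τ) x‖ₑ = ‖projFourier m u v τ x‖ₑ := by
  rw [← RCLike.enorm_conj (projFourier m u v τ x)]
  unfold projFourier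
  rw [← integral_conj]
  congr 2 with z
  rw [← Complex.exp_conj, map_mul, Complex.conj_I, Complex.conj_ofReal, neg_mul, neg_mul,
    Complex.ofReal_neg, mul_neg]

lemma enorm_projFourier_le {V : Type*} [NormedAddCommGroup V] [InnerProductSpace ℝ V] (m : Measure Z)
    (u : Z → ℝ) (v : Z → V) (τ : ℝ) (x : V) :
    ‖projFourier m u v τ x‖ₑ ≤ m univ := by
  refine (enorm_integral_le_lintegral_enorm _).trans ?_
  rw [← lintegral_one]
  refine lintegral_mono fun z => ?_
  rw [← ofReal_norm, Complex.norm_exp_I_mul_ofReal, ENNReal.ofReal_one]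

lemma Ici_zero_subset_dyadic : Ici (0 : ℝ) ⊆ Icc 0 1 ∪ ⋃ j : ℕ, Icc ((2 : ℝ) ^ j) (2 * 2 ^ j) := by
  intro t ht
  rcases le_total t 1 with h | h
  · exact Or.inl ⟨ht, h⟩
  · obtain ⟨j, hj1, hj2⟩ := exists_nat_pow_near h (one_lt_two (α := ℝ))
    exact Or.inr (mem_iUnion.2 ⟨j, hj1, by rw [← pow_succ']; exact hj2.le⟩)

/-- **Exceptional projections.** If `m` has correlation exponent `a` under `(u, v)`, then for
almost every `x` with respect to a Frostman measure of exponent `s > d + 1 - a`, the law of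
`u + ⟪v, x⟫` is absolutely continuous. -/
theorem ae_map_absolutelyContinuous (hu : Measurable u) (hv : Measurable v) {N : ℝ}
    (hN : ∀ᵐ z ∂m, ‖v z‖ ≤ N) {a : ℝ} (ha : 0 ≤ a) {C : ℝ≥0∞}
    (hcorr : ∀ r, 0 < r → (m.prod m) {p | |u p.1 - u p.2| ≤ r ∧ ‖v p.1 - v p.2‖ ≤ r} ≤
      C * ENNReal.ofReal r ^ a) (hC : C ≠ ∞)
    (μ : Measure V) [IsFiniteMeasure μ] {s : ℝ} (hs : 0 ≤ s) {D : ℝ≥0∞} (hD : D ≠ ∞)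
    (hball : ∀ x r, 0 < r → μ (Metric.closedBall x r) ≤ D * ENNReal.ofReal r ^ s) {M : ℝ}
    (hM : ∀ᵐ x ∂μ, ‖x‖ ≤ M) (hsa : (Module.finrank ℝ V : ℝ) + 1 < s + a) :
    ∀ᵐ x ∂μ, m.map (fun z => u z + inner ℝ (v z) x) ≪ volume := by
  obtain ⟨K, hK, hKR⟩ := lintegral_sq_projFourier_Icc_le hu hv hN ha hcorr hC μ hs hD hball hM
  set g : V → ℝ → ℝ≥0∞ := fun x τ => ‖projFourier m u v τ x‖ₑ ^ 2 with hg
  have hgm : Measurable (Function.uncurry g) := measurable_sq_projFourier hu hv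
  have hgx : ∀ x, Measurable (g x) := fun x => hgm.of_uncurry_left
  have hblock : ∀ S : Set ℝ, Measurable fun x => ∫⁻ τ in S, g x τ := fun S =>
    hgm.uncurry_setLIntegral S
  have hpos : ∫⁻ x, (∫⁻ τ in Ici 0, g x τ) ∂μ ≠ ∞ := by
    -- Frequencies below 1 are bounded trivially by the total mass; the dyadic blocks above 1 will
    -- form a convergent geometric series. Negative frequencies follow by conjugation.
    have hle : ∀ x, ∫⁻ τ in Ici 0, g x τ ≤ (m univ) ^ 2 +
        ∑' j : ℕ, ∫⁻ τ in Icc ((2 : ℝ) ^ j) (2 * 2 ^ j), g x τ := by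
      intro x
      refine (lintegral_mono_set Ici_zero_subset_dyadic).trans ((lintegral_union_le _ _ _).trans ?_)
      gcongr
      · calc ∫⁻ τ in Icc (0 : ℝ) 1, g x τ ≤ ∫⁻ τ in Icc (0 : ℝ) 1, (m univ) ^ 2 := by
              refine lintegral_mono fun τ => ?_
              exact pow_le_pow_left₀ zero_le (enorm_projFourier_le m u v τ x) 2
          _ = (m univ) ^ 2 := by simp
      · exact lintegral_iUnion_le _ _
    refine ne_top_of_le_ne_top ?_ (lintegral_mono hle)
    rw [lintegral_add_left measurable_const, lintegral_const,
      lintegral_tsum fun j => (hblock _).aemeasurable]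
    refine ENNReal.add_ne_top.2 ⟨ENNReal.mul_ne_top (ENNReal.pow_ne_top (measure_ne_top _ _))
      (measure_ne_top _ _), ?_⟩
    set e : ℝ := (Module.finrank ℝ V : ℝ) + 1 - s - a with he
    have he0 : e < 0 := by linarith
    refine ne_top_of_le_ne_top ?_ (ENNReal.tsum_le_tsum fun j =>
      hKR ((2 : ℝ) ^ j) (one_le_pow₀ one_le_two))
    rw [ENNReal.tsum_mul_left]
    refine ENNReal.mul_ne_top hK ?_
    have hgeo : ∀ j : ℕ, ENNReal.ofReal ((2 : ℝ) ^ j) ^ e = ENNReal.ofReal (((2 : ℝ) ^ e) ^ j) := by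
      intro j
      rw [ENNReal.ofReal_rpow_of_pos (by positivity), ← Real.rpow_natCast, ← Real.rpow_natCast,
        ← Real.rpow_mul two_pos.le, ← Real.rpow_mul two_pos.le, mul_comm]
    simp_rw [hgeo]
    exact (summable_geometric_of_lt_one (by positivity)
      (Real.rpow_lt_one_of_one_lt_of_neg one_lt_two he0)).tsum_ofReal_ne_top
  have hae := ae_lt_top (hblock (Ici 0)) hpos
  filter_upwards [hae] with x hx
  have hfm : Measurable fun z => u z + inner ℝ (v z) x := hu.add (hv.inner measurable_const)
  refine map_absolutelyContinuous_of_lintegral_sq m hfm ?_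
  have hsub : ∫⁻ τ, g x τ ≤ 2 * ∫⁻ τ in Ici 0, g x τ := by
    have h1 : ∫⁻ τ in Iic 0, g x τ = ∫⁻ τ in Ici 0, g x τ := by
      rw [← lintegral_indicator measurableSet_Iic, ← lintegral_indicator measurableSet_Ici,
        ← lintegral_neg_eq_self]
      congr 1 with τ
      simp only [indicator, mem_Iic, mem_Ici, Left.neg_nonpos_iff, hg, enorm_projFourier_neg]
    calc ∫⁻ τ, g x τ = ∫⁻ τ in Iic 0 ∪ Ici 0, g x τ := by rw [Iic_union_Ici, Measure.restrict_univ]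
      _ ≤ _ := lintegral_union_le _ _ _
      _ = _ := by rw [h1, two_mul]
  exact ne_top_of_le_ne_top (ENNReal.mul_ne_top ENNReal.ofNat_ne_top hx.ne) hsub
end Projection

/-! ### Energies and near-rectangles -/

section Correlation
variable {V : Type*} [NormedAddCommGroup V] [MeasurableSpace V] [BorelSpace V]

lemma measure_singleton_eq_zero_of_ball_le {V : Type*} [PseudoMetricSpace V] [MeasurableSpace V]
    (μ : Measure V) {s : ℝ} (hs : 0 < s) {D : ℝ≥0∞} (hD : D ≠ ∞)
    (hball : ∀ x r, 0 < r → μ (Metric.closedBall x r) ≤ D * ENNReal.ofReal r ^ s) (w : V) :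
    μ {w} = 0 := by
  have hlim : Tendsto (fun r : ℝ => D * ENNReal.ofReal r ^ s) (𝓝[>] 0) (𝓝 0) := by
    have h1 : Tendsto (fun r : ℝ => ENNReal.ofReal r ^ s) (𝓝 0) (𝓝 0) := by
      have : Continuous fun r : ℝ => ENNReal.ofReal r ^ s :=
        ENNReal.continuous_rpow_const.comp ENNReal.continuous_ofReal
      simpa [ENNReal.zero_rpow_of_pos hs] using this.tendsto 0
    have h2 := ENNReal.Tendsto.const_mul h1 (Or.inr hD)
    rw [mul_zero] at h2
    exact h2.mono_left nhdsWithin_le_nhds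
  refine le_antisymm (ge_of_tendsto hlim (eventually_nhdsWithin_of_forall fun r hr => ?_)) zero_le
  refine (measure_mono ?_).trans (hball w r hr)
  simpa using (le_of_lt hr : (0 : ℝ) ≤ r)

/-- Finiteness of the `b`-energy potential of an `s`-Frostman measure for `b < s`. -/
lemma exists_lintegral_enorm_rpow_neg_le (μ : Measure V) [IsProbabilityMeasure μ] {s b : ℝ}
    (hb : 0 ≤ b) (hbs : b < s) {D : ℝ≥0∞} (hD : D ≠ ∞)
    (hball : ∀ x r, 0 < r → μ (Metric.closedBall x r) ≤ D * ENNReal.ofReal r ^ s) :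
    ∃ K : ℝ≥0∞, K ≠ ∞ ∧ ∀ p, ∫⁻ w, ‖w - p‖ₑ ^ (-b) ∂μ ≤ K := by
  have hs : 0 < s := hb.trans_lt hbs
  refine ⟨1 + ∑' k : ℕ, D * ENNReal.ofReal ((2 : ℝ) ^ b * ((2 : ℝ) ^ (b - s)) ^ k), ?_, fun p => ?_⟩
  · refine ENNReal.add_ne_top.2 ⟨ENNReal.one_ne_top, ?_⟩
    rw [ENNReal.tsum_mul_left]
    refine ENNReal.mul_ne_top hD ?_
    exact ((summable_geometric_of_lt_one (by positivity)
      (Real.rpow_lt_one_of_one_lt_of_neg one_lt_two (by linarith))).mul_left _).tsum_ofReal_ne_top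
  have hpt : ∀ᵐ w ∂μ, ‖w - p‖ₑ ^ (-b) ≤ 1 + ∑' k : ℕ,
      (Metric.closedBall p ((2 : ℝ)⁻¹ ^ k)).indicator
        (fun _ => ENNReal.ofReal ((2 : ℝ) ^ ((k + 1) * b))) w := by
    -- The point `p` must be discarded, since for `b > 0` the kernel is infinite there.
    have hne : ∀ᵐ w ∂μ, w ≠ p := by
      rw [ae_iff]
      simpa using measure_singleton_eq_zero_of_ball_le μ hs hD hball p
    filter_upwards [hne] with w hw
    have hr : 0 < ‖w - p‖ := norm_pos_iff.2 (sub_ne_zero.2 hw)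
    rw [← ofReal_norm, ENNReal.ofReal_rpow_of_pos hr]
    rcases le_total 1 ‖w - p‖ with h1 | h1
    · refine le_trans ?_ le_self_add
      exact ENNReal.ofReal_le_one.2 (Real.rpow_le_one_of_one_le_of_nonpos h1 (by linarith))
    · obtain ⟨k, hk1, hk2⟩ := exists_nat_pow_near_of_lt_one hr h1
        (by norm_num : (0 : ℝ) < 2⁻¹) (by norm_num)
      refine le_trans ?_ le_add_self
      refine le_trans ?_ (ENNReal.le_tsum k)
      rw [indicator_of_mem (by simpa [dist_eq_norm] using hk2)]
      refine ENNReal.ofReal_le_ofReal ?_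
      calc ‖w - p‖ ^ (-b) ≤ ((2 : ℝ)⁻¹ ^ (k + 1)) ^ (-b) :=
            Real.rpow_le_rpow_of_nonpos (by positivity) hk1.le (by linarith)
        _ = (2 : ℝ) ^ ((k + 1) * b) := by
            rw [inv_pow, Real.inv_rpow (by positivity), Real.rpow_neg (by positivity), inv_inv,
              ← Real.rpow_natCast, ← Real.rpow_mul two_pos.le]
            push_cast; rfl
  refine (lintegral_mono_ae hpt).trans ?_
  rw [lintegral_add_left measurable_const, lintegral_const, measure_univ, mul_one,
    lintegral_tsum fun k => (measurable_const.indicator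
      Metric.isClosed_closedBall.measurableSet).aemeasurable]
  gcongr with k
  rw [lintegral_indicator_const Metric.isClosed_closedBall.measurableSet]
  calc ENNReal.ofReal ((2 : ℝ) ^ ((k + 1) * b)) * μ (Metric.closedBall p ((2 : ℝ)⁻¹ ^ k))
      ≤ ENNReal.ofReal ((2 : ℝ) ^ ((k + 1) * b)) * (D * ENNReal.ofReal ((2 : ℝ)⁻¹ ^ k) ^ s) := by
        gcongr
        exact hball _ _ (by positivity)
    _ = D * (ENNReal.ofReal ((2 : ℝ) ^ ((k + 1) * b)) * ENNReal.ofReal ((2 : ℝ)⁻¹ ^ k) ^ s) := by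
        ring
    _ = _ := by
        rw [ENNReal.ofReal_rpow_of_pos (by positivity), ← ENNReal.ofReal_mul (by positivity)]
        congr 2
        rw [inv_pow, ← Real.rpow_natCast, ← Real.rpow_neg two_pos.le, ← Real.rpow_mul two_pos.le,
          ← Real.rpow_natCast, ← Real.rpow_mul two_pos.le, ← Real.rpow_add two_pos,
          ← Real.rpow_add two_pos]
        congr 1; ring

/-- If p + q = w + z and the sums of squares agree, then p, w, q, z is a rectangle with diagonals pq
and wz. The proof is the stable version of the identity |p|² + |q|² - |w|² - |p + q - w|² = -2⟪w -
p, w - q⟫. -/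
lemma abs_inner_sub_sub_le {V : Type*} [NormedAddCommGroup V] [InnerProductSpace ℝ V] {M r : ℝ} {p q w z : V} (hp : ‖p‖ ≤ M) (hq : ‖q‖ ≤ M) (hw : ‖w‖ ≤ M)
    (hz : ‖z‖ ≤ M) (hu : |(‖p‖ ^ 2 + ‖q‖ ^ 2) - (‖w‖ ^ 2 + ‖z‖ ^ 2)| ≤ r)
    (hv : ‖(-2 : ℝ) • (p + q) - (-2 : ℝ) • (w + z)‖ ≤ r) :
    ‖z - (p + q - w)‖ ≤ r ∧ |inner ℝ (w - p) (w - q)| ≤ (1 + M) * r := by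
  have hr : 0 ≤ r := (norm_nonneg _).trans hv
  have hv' : 2 * ‖z - (p + q - w)‖ ≤ r := by
    have e : (-2 : ℝ) • (p + q) - (-2 : ℝ) • (w + z) = (2 : ℝ) • (z - (p + q - w)) := by module
    rwa [e, norm_smul, Real.norm_of_nonneg zero_le_two] at hv
  refine ⟨by linarith [norm_nonneg (z - (p + q - w))], ?_⟩
  have key : ‖z‖ ^ 2 - ‖p + q - w‖ ^ 2 = inner ℝ (z - (p + q - w)) (z + (p + q - w)) := by
    rw [inner_sub_left, inner_add_right, inner_add_right, real_inner_self_eq_norm_sq,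
      real_inner_self_eq_norm_sq, real_inner_comm z (p + q - w)]
    ring
  have key2 : ‖p‖ ^ 2 + ‖q‖ ^ 2 - ‖w‖ ^ 2 - ‖p + q - w‖ ^ 2 = -2 * inner ℝ (w - p) (w - q) := by
    simp only [← real_inner_self_eq_norm_sq, inner_sub_left, inner_sub_right, inner_add_left,
      inner_add_right, real_inner_comm p w, real_inner_comm q w, real_inner_comm q p]
    ring
  have hsum : ‖z + (p + q - w)‖ ≤ 4 * M := by
    calc ‖z + (p + q - w)‖ ≤ ‖z‖ + (‖p‖ + ‖q‖ + ‖w‖) :=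
          (norm_add_le _ _).trans (by gcongr; exact (norm_sub_le _ _).trans (by gcongr; exact norm_add_le _ _))
      _ ≤ 4 * M := by linarith
  have h1 : |‖z‖ ^ 2 - ‖p + q - w‖ ^ 2| ≤ 2 * M * r := by
    rw [key]
    calc _ ≤ ‖z - (p + q - w)‖ * ‖z + (p + q - w)‖ := abs_real_inner_le_norm _ _
      _ ≤ (r / 2) * (4 * M) := by gcongr; linarith
      _ = 2 * M * r := by ring
  have h2 := abs_le.1 hu
  have h3 := abs_le.1 h1
  rw [abs_le]
  constructor <;> nlinarith

variable [InnerProductSpace ℝ V] [SecondCountableTopology V]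

/-- Correlation bound for the image of `μ × μ` on the sum set of the paraboloid. -/
lemma exists_correlation_le (μ : Measure V) [IsProbabilityMeasure μ] {s b : ℝ}
    (hb : 0 ≤ b) (hbs : b < s) {D : ℝ≥0∞} (hD : D ≠ ∞)
    (hball : ∀ x r, 0 < r → μ (Metric.closedBall x r) ≤ D * ENNReal.ofReal r ^ s)
    {M : ℝ} (hM0 : 0 ≤ M) (hM : ∀ᵐ x ∂μ, ‖x‖ ≤ M) {S : ℝ≥0∞} (hS : S ≠ ∞)
    (hstrip : ∀ (n w : V) (t : ℝ), 0 < t →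
      μ {q | |inner ℝ n (w - q)| ≤ t} ≤ S * (ENNReal.ofReal t / ‖n‖ₑ) ^ b) :
    ∃ C : ℝ≥0∞, C ≠ ∞ ∧ ∀ r, 0 < r → ((μ.prod μ).prod (μ.prod μ))
      {p | |(‖p.1.1‖ ^ 2 + ‖p.1.2‖ ^ 2) - (‖p.2.1‖ ^ 2 + ‖p.2.2‖ ^ 2)| ≤ r ∧
        ‖(-2 : ℝ) • (p.1.1 + p.1.2) - (-2 : ℝ) • (p.2.1 + p.2.2)‖ ≤ r} ≤
      C * ENNReal.ofReal r ^ (s + b) := by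
  obtain ⟨K, hK, hKp⟩ := exists_lintegral_enorm_rpow_neg_le μ hb hbs hD hball
  refine ⟨D * (S * ENNReal.ofReal (1 + M) ^ b * K), ?_, fun r hr => ?_⟩
  · exact ENNReal.mul_ne_top hD (ENNReal.mul_ne_top (ENNReal.mul_ne_top hS
      (ENNReal.rpow_ne_top_of_nonneg hb ENNReal.ofReal_ne_top)) hK)
  let T : V → V → V → ℝ≥0∞ := fun p q w =>
    {x : V × V × V | |inner ℝ (x.2.2 - x.1) (x.2.2 - x.2.1)| ≤ (1 + M) * r}.indicator 1 (p, q, w)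
  have hTm : Measurable fun x : V × V × V => T x.1 x.2.1 x.2.2 := by
    refine measurable_one.indicator (measurableSet_le ?_ measurable_const)
    have h1 : Measurable fun x : V × V × V => x.2.2 - x.1 := by fun_prop
    have h2 : Measurable fun x : V × V × V => x.2.2 - x.2.1 := by fun_prop
    exact (h1.inner h2).abs
  let B : V → V → V → V → ℝ≥0∞ := fun p q w z =>
    (Metric.closedBall (p + q - w) r).indicator 1 z
  set A : Set ((V × V) × (V × V)) := {p | |(‖p.1.1‖ ^ 2 + ‖p.1.2‖ ^ 2) - (‖p.2.1‖ ^ 2 + ‖p.2.2‖ ^ 2)| ≤ r ∧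
        ‖(-2 : ℝ) • (p.1.1 + p.1.2) - (-2 : ℝ) • (p.2.1 + p.2.2)‖ ≤ r} with hA
  have hAm : MeasurableSet A := by
    have h1 : Measurable fun p : (V × V) × (V × V) =>
        |(‖p.1.1‖ ^ 2 + ‖p.1.2‖ ^ 2) - (‖p.2.1‖ ^ 2 + ‖p.2.2‖ ^ 2)| := by fun_prop
    have h2 : Measurable fun p : (V × V) × (V × V) =>
        ‖(-2 : ℝ) • (p.1.1 + p.1.2) - (-2 : ℝ) • (p.2.1 + p.2.2)‖ := by fun_prop
    exact (measurableSet_le h1 measurable_const).inter (measurableSet_le h2 measurable_const)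
  have hAi : Measurable (A.indicator (1 : (V × V) × (V × V) → ℝ≥0∞)) := measurable_one.indicator hAm
  have hle : ∀ p, ‖p‖ ≤ M → ∀ q, ‖q‖ ≤ M → ∀ w, ‖w‖ ≤ M → ∀ z, ‖z‖ ≤ M →
      A.indicator 1 ((p, q), (w, z)) ≤ T p q w * B p q w z := by
    intro p hp q hq w hw z hz
    by_cases h : ((p, q), (w, z)) ∈ A
    · obtain ⟨h1, h2⟩ := abs_inner_sub_sub_le hp hq hw hz h.1 h.2
      simp only [T, B]
      rw [indicator_of_mem h, indicator_of_mem (by exact h2),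
        indicator_of_mem (by simpa [dist_eq_norm] using h1)]
      simp
    · rw [indicator_of_notMem h]; exact zero_le
  have hstep : ∀ p w, ∫⁻ q, T p q w ∂μ ≤
      S * ENNReal.ofReal ((1 + M) * r) ^ b * ‖w - p‖ₑ ^ (-b) := by
    intro p w
    have e : (fun q => T p q w) = {q | |inner ℝ (w - p) (w - q)| ≤ (1 + M) * r}.indicator 1 := rfl
    have hm : MeasurableSet {q | |inner ℝ (w - p) (w - q)| ≤ (1 + M) * r} :=
      measurableSet_le ((Measurable.inner measurable_const (by fun_prop)).abs) measurable_const
    rw [e, lintegral_indicator_one hm]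
    refine (hstrip (w - p) w _ (by positivity)).trans_eq ?_
    rw [ENNReal.div_rpow_of_nonneg _ _ hb, ENNReal.rpow_neg, div_eq_mul_inv, mul_assoc]
  calc ((μ.prod μ).prod (μ.prod μ)) A
      = ∫⁻ p, ∫⁻ q, ∫⁻ w, ∫⁻ z, A.indicator 1 ((p, q), (w, z)) ∂μ ∂μ ∂μ ∂μ := by
        rw [← lintegral_indicator_one hAm, lintegral_prod _ hAi.aemeasurable,
          lintegral_prod _ hAi.lintegral_prod_right'.aemeasurable]
        congr 1 with p
        congr 1 with q
        exact lintegral_prod _ (hAi.comp measurable_prodMk_left).aemeasurable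
    -- Integrating `z` first uses the ball bound. Swapping `q` and `w` then exposes the strip in
    -- `q`, whose loss ‖w - p‖^(-b) is integrable in `w` because `b < s`.
    _ ≤ ∫⁻ p, ∫⁻ q, ∫⁻ w, T p q w * (D * ENNReal.ofReal r ^ s) ∂μ ∂μ ∂μ := by
        refine lintegral_mono_ae ?_
        filter_upwards [hM] with p hp
        refine lintegral_mono_ae ?_
        filter_upwards [hM] with q hq
        refine lintegral_mono_ae ?_
        filter_upwards [hM] with w hw
        calc ∫⁻ z, A.indicator 1 ((p, q), (w, z)) ∂μ ≤ ∫⁻ z, T p q w * B p q w z ∂μ := by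
              refine lintegral_mono_ae ?_
              filter_upwards [hM] with z hz
              exact hle p hp q hq w hw z hz
          _ = T p q w * μ (Metric.closedBall (p + q - w) r) := by
              rw [lintegral_const_mul _ (measurable_one.indicator
                Metric.isClosed_closedBall.measurableSet),
                lintegral_indicator_one Metric.isClosed_closedBall.measurableSet]
          _ ≤ _ := by gcongr; exact hball _ _ hr
    _ = ∫⁻ p, ∫⁻ w, (∫⁻ q, T p q w ∂μ) * (D * ENNReal.ofReal r ^ s) ∂μ ∂μ := by
        congr 1 with p
        have hTp : Measurable fun x : V × V => T p x.1 x.2 := hTm.comp measurable_prodMk_left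
        rw [lintegral_lintegral_swap (by exact (hTp.mul_const _).aemeasurable)]
        congr 1 with w
        rw [lintegral_mul_const]
        exact hTp.comp (measurable_prodMk_right (y := w))
    _ ≤ ∫⁻ p, ∫⁻ w, (S * ENNReal.ofReal ((1 + M) * r) ^ b * ‖w - p‖ₑ ^ (-b)) *
          (D * ENNReal.ofReal r ^ s) ∂μ ∂μ := by
        gcongr with p w
        exact hstep p w
    _ ≤ ∫⁻ p, (S * ENNReal.ofReal ((1 + M) * r) ^ b * K) * (D * ENNReal.ofReal r ^ s) ∂μ := by
        refine lintegral_mono fun p => ?_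
        rw [lintegral_mul_const _ (by fun_prop), lintegral_const_mul _ (by fun_prop)]
        gcongr
        exact hKp p
    _ = _ := by
        rw [lintegral_const, measure_univ, mul_one, ENNReal.ofReal_mul (by positivity),
          ENNReal.mul_rpow_of_nonneg _ _ hb, ENNReal.rpow_add_of_nonneg _ _ (by linarith) hb]
        ring
end Correlation

/-! ### Measures of strips -/

section Strip

/-- Disposes of wide strips, including the degenerate normal n = 0, for which the relative width is
infinite. -/
lemma measure_le_mul_rpow_of_one_le {V : Type*} [MeasurableSpace V] (μ : Measure V)
    [IsProbabilityMeasure μ] (A : Set V) {S ρ : ℝ≥0∞} (hS : 1 ≤ S) {b : ℝ} (hb : 0 ≤ b)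
    (hρ : 1 ≤ ρ) : μ A ≤ S * ρ ^ b := by
  refine prob_le_one.trans ?_
  rw [← one_mul (1 : ℝ≥0∞), ← ENNReal.one_rpow b]
  gcongr
  simpa using hS

lemma strip_le_dim_one (μ : Measure (EuclideanSpace ℝ (Fin 1))) [IsProbabilityMeasure μ] {s b : ℝ}
    (hb : 0 ≤ b) (hbs : b ≤ s) {D : ℝ≥0∞}
    (hball : ∀ x r, 0 < r → μ (Metric.closedBall x r) ≤ D * ENNReal.ofReal r ^ s)
    (n w : EuclideanSpace ℝ (Fin 1)) {t : ℝ} (ht : 0 < t) :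
    μ {q | |inner ℝ n (w - q)| ≤ t} ≤ max D 1 * (ENNReal.ofReal t / ‖n‖ₑ) ^ b := by
  rcases le_or_gt 1 (ENNReal.ofReal t / ‖n‖ₑ) with h | h
  · exact measure_le_mul_rpow_of_one_le μ _ (le_max_right _ _) hb h
  have hn : 0 < ‖n‖ := by
    rw [norm_pos_iff]
    rintro rfl
    rw [enorm_zero, ENNReal.div_zero (by simpa using ht)] at h
    exact not_top_lt h
  rw [← ofReal_norm, ← ENNReal.ofReal_div_of_pos hn] at h ⊢
  have hsub : {q | |inner ℝ n (w - q)| ≤ t} ⊆ Metric.closedBall w (t / ‖n‖) := by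
    intro q hq
    have hq' : |inner ℝ n (w - q)| ≤ t := hq
    rw [Metric.mem_closedBall, dist_comm, dist_eq_norm, le_div_iff₀ hn]
    refine le_trans (le_of_eq ?_) hq'
    simp only [EuclideanSpace.norm_eq, PiLp.inner_apply, Fin.sum_univ_one, Real.norm_eq_abs, sq_abs,
      Real.sqrt_sq_eq_abs, RCLike.inner_apply, conj_trivial, abs_mul]
  calc μ {q | |inner ℝ n (w - q)| ≤ t} ≤ D * ENNReal.ofReal (t / ‖n‖) ^ s :=
        (measure_mono hsub).trans (hball _ _ (by positivity))
    _ ≤ max D 1 * ENNReal.ofReal (t / ‖n‖) ^ b :=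
        mul_le_mul' (le_max_left _ _) (ENNReal.rpow_le_rpow_of_exponent_ge h.le hbs)

/-- Within the ball of radius M, a strip of half-width ρ is covered by O(1/ρ) balls of radius 3ρ,
each of mass O(ρ^s); hence the exponent s - 1. -/
lemma strip_le_dim_two (μ : Measure (EuclideanSpace ℝ (Fin 2))) [IsProbabilityMeasure μ] {s : ℝ}
    (hs : 1 ≤ s) {D : ℝ≥0∞}
    (hball : ∀ x r, 0 < r → μ (Metric.closedBall x r) ≤ D * ENNReal.ofReal r ^ s)
    {M : ℝ} (hM0 : 0 ≤ M) (hM : ∀ᵐ x ∂μ, ‖x‖ ≤ M)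
    (n w : EuclideanSpace ℝ (Fin 2)) {t : ℝ} (ht : 0 < t) :
    μ {q | |inner ℝ n (w - q)| ≤ t} ≤
      max (ENNReal.ofReal (2 * M + 2) * D * ENNReal.ofReal 3 ^ s) 1 *
        (ENNReal.ofReal t / ‖n‖ₑ) ^ (s - 1) := by
  rcases le_or_gt 1 (ENNReal.ofReal t / ‖n‖ₑ) with h | h
  · exact measure_le_mul_rpow_of_one_le μ _ (le_max_right _ _) (by linarith) h
  have hn : 0 < ‖n‖ := by
    rw [norm_pos_iff]
    rintro rfl
    rw [enorm_zero, ENNReal.div_zero (by simpa using ht)] at h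
    exact not_top_lt h
  rw [← ofReal_norm, ← ENNReal.ofReal_div_of_pos hn] at h ⊢
  set ρ := t / ‖n‖ with hρ
  have hρ0 : 0 < ρ := by positivity
  have hρ1 : ρ ≤ 1 := ENNReal.ofReal_le_one.1 h.le
  have htρ : t = ‖n‖ * ρ := by rw [hρ]; field_simp
  -- `g` is ‖n‖ times the coordinate along the strip; `hid` is the Lagrange identity. Cutting `g`
  -- into intervals of length `t` gives the pieces `P j`.
  let g : EuclideanSpace ℝ (Fin 2) → ℝ := fun q => n 0 * q 1 - n 1 * q 0
  have hid : ∀ x : EuclideanSpace ℝ (Fin 2),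
      ‖n‖ ^ 2 * ‖x‖ ^ 2 = (inner ℝ n x) ^ 2 + (n 0 * x 1 - n 1 * x 0) ^ 2 := by
    intro x
    rw [EuclideanSpace.norm_sq_eq, EuclideanSpace.norm_sq_eq]
    simp only [PiLp.inner_apply, Fin.sum_univ_two, Real.norm_eq_abs, sq_abs, RCLike.inner_apply,
      conj_trivial]
    ring
  set J := Finset.Icc ⌊-(M / ρ)⌋ ⌊M / ρ⌋ with hJ
  let P : ℤ → Set (EuclideanSpace ℝ (Fin 2)) := fun j =>
    {q | |inner ℝ n (w - q)| ≤ t ∧ ⌊g q / t⌋ = j}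
  have hcover : {q | |inner ℝ n (w - q)| ≤ t} ≤ᵐ[μ] ⋃ j ∈ J, P j := by
    filter_upwards [hM] with q hq hqs
    refine mem_iUnion₂.2 ⟨⌊g q / t⌋, ?_, hqs, rfl⟩
    have hg : |g q| ≤ ‖n‖ * M := by
      refine abs_le_of_sq_le_sq (le_trans ?_ (pow_le_pow_left₀ (by positivity)
        (mul_le_mul_of_nonneg_left hq hn.le) 2)) (by positivity)
      rw [mul_pow, hid q]
      exact le_add_of_nonneg_left (sq_nonneg _)
    have hg' : |g q / t| ≤ M / ρ := by
      rw [abs_div, abs_of_pos ht, htρ, ← mul_div_mul_left M ρ hn.ne']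
      gcongr
    exact Finset.mem_Icc.2 ⟨Int.floor_mono (abs_le.1 hg').1, Int.floor_mono (abs_le.1 hg').2⟩
  have hP : ∀ j, μ (P j) ≤ D * ENNReal.ofReal (3 * ρ) ^ s := by
    intro j
    rcases (P j).eq_empty_or_nonempty with he | ⟨q₀, hq₀⟩
    · rw [he, measure_empty]; exact zero_le
    refine (measure_mono fun q hq => ?_).trans (hball q₀ (3 * ρ) (by positivity))
    rw [Metric.mem_closedBall, dist_eq_norm]
    have h1 : |inner ℝ n (q - q₀)| ≤ 2 * t := by
      have e : inner ℝ n (q - q₀) = inner ℝ n (w - q₀) - inner ℝ n (w - q) := by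
        rw [← inner_sub_right]; congr 1; abel
      rw [e]
      have e1 := abs_le.1 hq₀.1
      have e2 := abs_le.1 hq.1
      exact abs_le.2 ⟨by linarith, by linarith⟩
    have h2 : |n 0 * (q - q₀) 1 - n 1 * (q - q₀) 0| ≤ t := by
      have e := Int.abs_sub_lt_one_of_floor_eq_floor (hq.2.trans hq₀.2.symm)
      rw [← sub_div, abs_div, abs_of_pos ht, div_lt_one ht] at e
      refine le_trans (le_of_eq ?_) e.le
      congr 1
      simp only [PiLp.sub_apply, g]
      ring
    have h3 : (‖n‖ * ‖q - q₀‖) ^ 2 ≤ (‖n‖ * (3 * ρ)) ^ 2 := by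
      rw [mul_pow, hid]
      have e1 := sq_le_sq' (by linarith [(abs_le.1 h1).1]) (abs_le.1 h1).2
      have e2 := sq_le_sq' (by linarith [(abs_le.1 h2).1]) (abs_le.1 h2).2
      have e3 : ‖n‖ * (3 * ρ) = 3 * t := by rw [htρ]; ring
      rw [e3]
      nlinarith [sq_nonneg t]
    exact le_of_mul_le_mul_left ((pow_le_pow_iff_left₀ (by positivity) (by positivity)
      two_ne_zero).1 h3) hn
  have hcard : (J.card : ℝ) ≤ (2 * M + 2) / ρ := by
    have hMρ : 0 ≤ M / ρ := by positivity
    have h1 : ((J.card : ℤ) : ℝ) = (⌊M / ρ⌋ : ℝ) + 1 - ⌊-(M / ρ)⌋ := by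
      rw [hJ, Int.card_Icc, Int.toNat_of_nonneg]
      · push_cast; rfl
      · have : ⌊-(M / ρ)⌋ ≤ ⌊M / ρ⌋ := Int.floor_mono (by linarith)
        linarith
    have h2 : (J.card : ℝ) = ((J.card : ℤ) : ℝ) := by push_cast; rfl
    rw [h2, h1]
    have h3 := Int.floor_le (M / ρ)
    have h4 := Int.lt_floor_add_one (-(M / ρ))
    have h5 : (2 * M + 2) / ρ = 2 * (M / ρ) + 2 * (1 / ρ) := by ring
    have h6 : 1 ≤ 1 / ρ := by rw [le_div_iff₀ hρ0]; linarith
    linarith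
  calc μ {q | |inner ℝ n (w - q)| ≤ t} ≤ μ (⋃ j ∈ J, P j) := measure_mono_ae hcover
    _ ≤ ∑ j ∈ J, μ (P j) := measure_biUnion_finset_le _ _
    _ ≤ J.card • (D * ENNReal.ofReal (3 * ρ) ^ s) := Finset.sum_le_card_nsmul _ _ _ fun j _ => hP j
    _ ≤ ENNReal.ofReal ((2 * M + 2) / ρ) * (D * ENNReal.ofReal (3 * ρ) ^ s) := by
        rw [nsmul_eq_mul, ← ENNReal.ofReal_natCast]
        gcongr
    _ = (ENNReal.ofReal (2 * M + 2) * D * ENNReal.ofReal 3 ^ s) * ENNReal.ofReal ρ ^ (s - 1) := by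
        have e : ENNReal.ofReal ρ ^ (s - 1) = ENNReal.ofReal ρ ^ s * (ENNReal.ofReal ρ)⁻¹ := by
          rw [ENNReal.rpow_sub _ _ (by simpa using hρ0) ENNReal.ofReal_ne_top, ENNReal.rpow_one,
            div_eq_mul_inv]
        rw [e, ENNReal.ofReal_div_of_pos hρ0, ENNReal.ofReal_mul (by norm_num),
          ENNReal.mul_rpow_of_nonneg _ _ (by linarith), div_eq_mul_inv]
        ring
    _ ≤ _ := by
        gcongr
        exact le_max_left _ _
end Strip

/-! ### From absolutely continuous laws to pinned box sets -/

lemma volume_image_sq_sub_eq_zero {P : Set ℝ} (hP : volume P = 0) (c : ℝ) :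
    volume ((fun t : ℝ => t ^ 2 - c) '' P) = 0 :=
  addHaar_image_eq_zero_of_differentiableOn_of_addHaar_eq_zero volume (by fun_prop) hP

lemma sqrt_sum_mem_pinnedBoxSet {n d : ℕ} {x : EuclideanSpace ℝ (Fin d)}
    {E : Set (EuclideanSpace ℝ (Fin d))} (T : Finset (EuclideanSpace ℝ (Fin d)))
    (hT : T.card = n) (hTE : ∀ y ∈ T, y ∈ E) :
    ∃ t ∈ pinnedBoxSet n x E, t ^ 2 = ∑ y ∈ T, ‖y - x‖ ^ 2 := by
  let e : Fin n ≃ T := (T.equivFinOfCardEq hT).symm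
  refine ⟨_, ⟨WithLp.toLp 2 fun i => (e i : EuclideanSpace ℝ (Fin d)), fun i => hTE _ (e i).2,
    fun i j hij h => hij (e.injective (Subtype.ext h)), rfl⟩, ?_⟩
  rw [PiLp.norm_sq_eq_of_L2]
  simp only [PiLp.sub_apply]
  rw [Equiv.sum_comp e fun y : T => ‖(y : EuclideanSpace ℝ (Fin d)) - x‖ ^ 2]
  exact Finset.sum_coe_sort T fun y => ‖y - x‖ ^ 2

/-- If the law of the sum of two squared distances to `x` is absolutely continuous, the pinned box
set at `x` has positive length. -/
lemma volume_pinnedBoxSet_pos {n d : ℕ} (hn : 2 ≤ n) {x : EuclideanSpace ℝ (Fin d)}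
    {E : Set (EuclideanSpace ℝ (Fin d))} (μ : Measure (EuclideanSpace ℝ (Fin d)))
    [IsProbabilityMeasure μ] (hμE : μ Eᶜ = 0) (hatom : ∀ w, μ {w} = 0)
    (hac : (μ.prod μ).map (fun z => (‖z.1‖ ^ 2 + ‖z.2‖ ^ 2) + inner ℝ ((-2 : ℝ) • (z.1 + z.2)) x) ≪
      volume) : 0 < volume (pinnedBoxSet n x E) := by
  classical
  by_contra hP
  replace hP : volume (pinnedBoxSet n x E) = 0 := by simpa using hP
  set f : EuclideanSpace ℝ (Fin d) × EuclideanSpace ℝ (Fin d) → ℝ :=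
    fun z => (‖z.1‖ ^ 2 + ‖z.2‖ ^ 2) + inner ℝ ((-2 : ℝ) • (z.1 + z.2)) x with hf
  have hfm : Measurable f :=
    Measurable.add (by fun_prop) (Measurable.inner (by fun_prop) measurable_const)
  have hEinf : E.Infinite := by
    intro hfin
    have h0 : μ E = 0 := by
      rw [← biUnion_of_singleton E]
      exact (measure_biUnion_null_iff hfin.countable).2 fun w _ => hatom w
    have : μ univ = 0 := by
      rw [← union_compl_self E]
      exact measure_union_null h0 hμE
    simp at this
  -- The remaining n - 2 points are taken from `F`. With n points available, enough survive the
  -- removal of `y₁` and `y₂`, and only finitely many subsets `T` occur, so the exceptional set `N`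
  -- is a finite union of null sets.
  obtain ⟨F, hFE, hFn⟩ := hEinf.exists_subset_card_eq n
  let c : Finset (EuclideanSpace ℝ (Fin d)) → ℝ := fun T => 2 * ‖x‖ ^ 2 + ∑ y ∈ T, ‖y - x‖ ^ 2
  set N : Set ℝ := ⋃ T ∈ F.powerset, (fun t : ℝ => t ^ 2 - c T) '' pinnedBoxSet n x E with hN
  have hN0 : volume N = 0 :=
    (measure_biUnion_null_iff F.powerset.countable_toSet).2 fun T _ =>
      volume_image_sq_sub_eq_zero hP _
  have hnull : (μ.prod μ) (f ⁻¹' N) = 0 := by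
    have h := hac hN0
    -- Only this inequality is needed, so `N` need not be shown measurable.
    exact le_antisymm ((Measure.le_map_apply hfm.aemeasurable N).trans h.le) zero_le
  have hE1 : ∀ᵐ z ∂(μ.prod μ), z.1 ∈ E := Measure.quasiMeasurePreserving_fst.ae hμE
  have hE2 : ∀ᵐ z ∂(μ.prod μ), z.2 ∈ E := Measure.quasiMeasurePreserving_snd.ae hμE
  have hdiag : ∀ᵐ z ∂(μ.prod μ), z.1 ≠ z.2 := by
    have hm : MeasurableSet {z : EuclideanSpace ℝ (Fin d) × EuclideanSpace ℝ (Fin d) | z.1 = z.2} :=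
      measurableSet_eq_fun measurable_fst measurable_snd
    rw [ae_iff]
    simp only [not_not]
    rw [Measure.measure_prod_null hm]
    refine Eventually.of_forall fun w => ?_
    have : Prod.mk w ⁻¹' {z : EuclideanSpace ℝ (Fin d) × EuclideanSpace ℝ (Fin d) | z.1 = z.2} =
        {w} := by ext y; simp [eq_comm]
    exact (congrArg μ this).trans (hatom w)
  have hfN : ∀ᵐ z ∂(μ.prod μ), f z ∉ N := by
    rw [ae_iff]; simp only [not_not]; exact hnull
  obtain ⟨⟨y₁, y₂⟩, h1, h2, h12, hz⟩ := (hE1.and (hE2.and (hdiag.and hfN))).exists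
  dsimp only at h1 h2 h12
  apply hz
  obtain ⟨T, hTF, hTn⟩ := Finset.exists_subset_card_eq (s := F \ {y₁, y₂}) (n := n - 2) (by
    have h := Finset.le_card_sdiff {y₁, y₂} F
    rw [Finset.card_pair h12, hFn] at h
    exact h)
  have hTF' : ∀ y ∈ T, y ∈ F ∧ y ≠ y₁ ∧ y ≠ y₂ := fun y hy => by
    simpa using hTF hy
  have hy2 : y₂ ∉ T := fun h => (hTF' _ h).2.2 rfl
  have hy1 : y₁ ∉ insert y₂ T := by
    rw [Finset.mem_insert, not_or]
    exact ⟨h12, fun h => (hTF' _ h).2.1 rfl⟩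
  obtain ⟨t, ht, htsq⟩ := sqrt_sum_mem_pinnedBoxSet (x := x) (E := E) (n := n)
    (insert y₁ (insert y₂ T))
    (by rw [Finset.card_insert_of_notMem hy1, Finset.card_insert_of_notMem hy2, hTn]; omega)
    (by
      intro y hy
      rcases Finset.mem_insert.1 hy with rfl | hy
      · exact h1
      rcases Finset.mem_insert.1 hy with rfl | hy
      · exact h2
      exact hFE (hTF' y hy).1)
  refine mem_iUnion₂.2 ⟨T, Finset.mem_powerset.2 fun y hy => (hTF' y hy).1, t, ht, ?_⟩
  simp only [c, hf]
  rw [htsq, Finset.sum_insert hy1, Finset.sum_insert hy2, norm_sub_sq_real, norm_sub_sq_real,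
    inner_smul_left, inner_add_left]
  simp only [conj_trivial]
  ring

/-- A Frostman measure whose strips have exponent `b` yields pinned box sets of positive length
once `2 s + b > d + 1`. -/
lemma exists_volume_pinnedBoxSet_pos {n d : ℕ} (hn : 2 ≤ n)
    {E : Set (EuclideanSpace ℝ (Fin d))} (μ : Measure (EuclideanSpace ℝ (Fin d)))
    [IsProbabilityMeasure μ] (hμE : μ Eᶜ = 0) {s b : ℝ} (hb : 0 ≤ b) (hbs : b < s)
    (hsb : (d : ℝ) + 1 < 2 * s + b) {D : ℝ≥0∞} (hD : D ≠ ∞)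
    (hball : ∀ x r, 0 < r → μ (Metric.closedBall x r) ≤ D * ENNReal.ofReal r ^ s)
    {M : ℝ} (hM0 : 0 ≤ M) (hM : ∀ᵐ x ∂μ, ‖x‖ ≤ M) {S : ℝ≥0∞} (hS : S ≠ ∞)
    (hstrip : ∀ (n w : EuclideanSpace ℝ (Fin d)) (t : ℝ), 0 < t →
      μ {q | |inner ℝ n (w - q)| ≤ t} ≤ S * (ENNReal.ofReal t / ‖n‖ₑ) ^ b) :
    ∃ x ∈ E, 0 < volume (pinnedBoxSet n x E) := by
  have hs : 0 < s := hb.trans_lt hbs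
  obtain ⟨C, hC, hcorr⟩ := exists_correlation_le μ hb hbs hD hball hM0 hM hS hstrip
  have hu : Measurable fun z : EuclideanSpace ℝ (Fin d) × EuclideanSpace ℝ (Fin d) =>
      ‖z.1‖ ^ 2 + ‖z.2‖ ^ 2 := by fun_prop
  have hv : Measurable fun z : EuclideanSpace ℝ (Fin d) × EuclideanSpace ℝ (Fin d) =>
      (-2 : ℝ) • (z.1 + z.2) := by fun_prop
  have hN : ∀ᵐ z ∂(μ.prod μ), ‖(-2 : ℝ) • (z.1 + z.2)‖ ≤ 2 * (M + M) := by
    filter_upwards [Measure.quasiMeasurePreserving_fst.ae hM,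
      Measure.quasiMeasurePreserving_snd.ae hM] with z h1 h2
    rw [norm_smul, norm_neg, Real.norm_of_nonneg zero_le_two]
    gcongr
    exact (norm_add_le _ _).trans (add_le_add h1 h2)
  have hae := ae_map_absolutelyContinuous hu hv hN (by linarith : 0 ≤ s + b) hcorr hC μ hs.le hD hball
    hM (by rw [finrank_euclideanSpace_fin]; linarith)
  have hmem : ∀ᵐ x ∂μ, x ∈ E := hμE
  obtain ⟨x, hx, hxE⟩ := (hae.and hmem).exists
  exact ⟨x, hxE, volume_pinnedBoxSet_pos hn μ hμE
    (measure_singleton_eq_zero_of_ball_le μ hs hD hball) hx⟩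

/-! ### Dimensional thresholds and conclusion -/

lemma three_fourths_le_boxThreshold {n : ℕ} (hn : 2 ≤ n) : (3 / 4 : ℝ) ≤ boxThreshold n 1 := by
  unfold boxThreshold
  split_ifs with h
  · simp
  · have hn3 : 3 ≤ n := by
      rcases hn.eq_or_lt with rfl | h'
      · exact absurd rfl h
      · exact h'
    have : (3 : ℝ) ≤ n := by exact_mod_cast hn3
    push_cast
    rw [one_mul, div_le_div_iff₀ (by norm_num) (by positivity)]
    linarith

lemma two_thirds_mul_le_boxThreshold {n d : ℕ} (hn : 2 ≤ n) (hd : d ≠ 1) :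
    (2 / 3 * d : ℝ) ≤ boxThreshold n d := by
  unfold boxThreshold
  rw [if_neg fun h => hd (Prod.ext_iff.1 h).2]
  have hn' : (2 : ℝ) ≤ n := by exact_mod_cast hn
  push_cast
  rw [mul_comm]
  refine mul_le_mul_of_nonneg_left ?_ (Nat.cast_nonneg d)
  rw [div_le_div_iff₀ (by norm_num) (by positivity)]
  linarith

theorem corollary4p8 (n d : ℕ) (hn : 2 ≤ n) (hd : 1 ≤ d)
    (E : Set (EuclideanSpace ℝ (Fin d))) (hE : IsCompact E)
    (hdim : (boxThreshold n d : ℝ≥0∞) < dimH E) :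
    ∃ x ∈ E, 0 < MeasureTheory.volume (pinnedBoxSet n x E) := by
  obtain ⟨s, hs1, hs2⟩ := ENNReal.lt_iff_exists_nnreal_btwn.1 hdim
  have hs1' : (boxThreshold n d : ℝ) < s := by exact_mod_cast hs1
  have hs0 : (0 : ℝ) < s := (NNReal.coe_nonneg _).trans_lt hs1'
  have hH : μH[(s : ℝ)] E ≠ 0 := by rw [hausdorffMeasure_of_lt_dimH hs2]; exact ENNReal.top_ne_zero
  obtain ⟨μ, hμ, hμE, D, hball⟩ := exists_frostman_measure hE hs0 hH
  obtain ⟨M, hM0, hM⟩ := hE.isBounded.exists_pos_norm_le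
  have hMae : ∀ᵐ x ∂μ, ‖x‖ ≤ M := by
    have hmem : ∀ᵐ x ∂μ, x ∈ E := hμE
    filter_upwards [hmem] with x hx using hM x hx
  have hD : (D : ℝ≥0∞) ≠ ∞ := ENNReal.coe_ne_top
  obtain rfl | rfl | hd3 : d = 1 ∨ d = 2 ∨ 3 ≤ d := by omega
  -- On the line a strip is an interval, so every `b ≤ s` is a strip exponent; `b = 1 / 2` gives 2s
  -- + b > 3/2 + 1/2 = d + 1.
  · have hs := (three_fourths_le_boxThreshold hn).trans_lt hs1'
    refine exists_volume_pinnedBoxSet_pos (b := 1 / 2) hn μ hμE (by norm_num) (by linarith)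
      (by push_cast; linarith) hD hball hM0.le hMae (S := max D 1) (by simp) fun n w t ht => ?_
    exact strip_le_dim_one μ (by norm_num) (by linarith) hball n w ht
  -- Here s > 4/3, so 2s + (s - 1) > 3 = d + 1.
  · have hs := (two_thirds_mul_le_boxThreshold hn (by norm_num : 2 ≠ 1)).trans_lt hs1'
    push_cast at hs
    refine exists_volume_pinnedBoxSet_pos (b := s - 1) hn μ hμE (by linarith) (by linarith)
      (by push_cast; linarith) hD hball hM0.le hMae ?_ fun n w t ht =>
        strip_le_dim_two μ (by linarith) hball hM0.le hMae n w ht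
    refine (max_lt ?_ ENNReal.one_lt_top).ne
    exact ENNReal.mul_lt_top (ENNReal.mul_lt_top ENNReal.ofReal_lt_top hD.lt_top)
      (ENNReal.rpow_lt_top_of_nonneg hs0.le ENNReal.ofReal_ne_top)
  -- No strip estimate is needed: 2s > 4d/3 ≥ d + 1 exactly when d ≥ 3.
  · have hs := (two_thirds_mul_le_boxThreshold hn (by omega : d ≠ 1)).trans_lt hs1'
    have hd3' : (3 : ℝ) ≤ d := by exact_mod_cast hd3
    refine exists_volume_pinnedBoxSet_pos (b := 0) hn μ hμE le_rfl hs0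
      (by linarith) hD hball hM0.le hMae (S := 1) ENNReal.one_ne_top fun n w t ht => ?_
    simpa using prob_le_one
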